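/- **HyperQPTL.** Fix atomic propositions $\mathrm{AP}$ and trace variables $\mathcal V$. HyperQPTL formulas are $\varphi ::= \forall\pi.\varphi \mid \exists\pi.\varphi \mid \forall q.\varphi \mid \exists q.\varphi \mid \psi$ and $\psi ::= a_\pi \mid q \mid \neg\psi \mid \psi\lor\psi \mid \mathsf{X}\psi \mid \mathsf{F}\psi$ with $a,q\in\mathrm{AP}$, $\pi\in\mathcal V$, where every $a_\pi$ is in the scope of a quantifier binding $\pi$, every $q$ is in the scope of a quantifier binding $q$, and no variable is quantified twice. For a set $T\subseteq(2^{\mathrm{AP}})^\omega$ of traces and a partial assignment $\Pi$ of traces to trace variables, $\Pi,i\models_T a_\pi$ iff $a\in\Pi(\pi)[i]$; $\Pi,i\models_T q$ iff $q\in t[i]$ for all $t\in T$; the Boolean and temporal operators are as usual; $\Pi,i\models_T\exists\pi.\varphi$ (resp. $\forall\pi.\varphi$) iff $\Pi[\pi\mapsto t],i\models_T\varphi$ for some (resp. all) $t\in T$; and $\Pi,i\models_T\exists q.\varphi$ (resp. $\forall q.\varphi$) iff $\Pi,i\models_{T[q\mapsto t_q]}\varphi$ for some (resp. all) $t_q\in(2^{\{q\}})^\omega$,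 where $T[q\mapsto t_q]$ replaces the $q$-sequence of every trace of $T$ by $t_q$. $T$ satisfies $\varphi$ if $\emptyset,0\models_T\varphi$. **Realizability.** Let $\mathrm{AP}=I\mathbin{\dot\cup}O$ be finite, with all quantified propositions in $O$. A formula $\varphi$ over $\mathrm{AP}$ is realizable if there is a strategy $f:(2^I)^*\to 2^O$ such that the set of all traces $w\in(2^{I\cup O})^\omega$ with $w_n\cap O=f((w_0\cap I)\cdots(w_{n-1}\cap I))$ for all $n\ge 0$ satisfies $\varphi$. The realizability problem asks, given $I$, $O$ and $\varphi$, whether $\varphi$ is realizable. Fragments are given by the shape of the quantifier prefix: $\forall_\pi,\exists_\pi$ stand for a trace quantifier, $\forall_q,\exists_q$ for a propositional quantifier, $Q_q$ for $\forall_q$ or $\exists_q$, $\exists_{q/\pi}$ for $\exists_q$ or $\exists_\pi$, and $^*$ for finite repetition. **Theorem.** Realizability is undecidable for HyperQPTL formulas with exactly one $\forall_\pi$ quantifier (and any other quantifiers) outside the $\exists_{q/\pi}^*\forall_q^*\forall_\pi Q_q^*$ fragment. In particular, realizability is undecidable for the $\forall_q^*\exists_q^*\forall_\pi$ fragment, and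 it is undecidable for the $\forall_\pi\exists_\pi$ fragment (formulas with prefix $\forall\pi.\exists\pi'$). -/

import Mathlib

open scoped Computability

namespace HyperQPTL

/-- Quantifier-free HyperQPTL formulas
`ψ ::= a_π | q | ¬ψ | ψ ∨ ψ | X ψ | F ψ`.
Atomic propositions and trace variables are named by natural numbers. -/
inductive Body : Type
  /-- `a_π`: the atomic proposition `a` on the trace bound to the trace variable `π` -/
  | atom (a π : ℕ) : Body
  /-- a quantified proposition `q` -/
  | prop (q : ℕ) : Body
  | neg (ψ : Body) : Body
  | or (ψ₁ ψ₂ : Body) : Body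
  | next (ψ : Body) : Body
  | eventually (ψ : Body) : Body

/-- HyperQPTL formulas `φ ::= ∀π.φ | ∃π.φ | ∀q.φ | ∃q.φ | ψ`. -/
inductive Formula : Type
  | body (ψ : Body) : Formula
  | allTrace (π : ℕ) (φ : Formula) : Formula
  | exTrace (π : ℕ) (φ : Formula) : Formula
  | allProp (q : ℕ) (φ : Formula) : Formula
  | exProp (q : ℕ) (φ : Formula) : Formula

/-! ### Semantics -/

/-- Infinite sequences of valuations (a valuation is the set of propositions that hold). -/
abbrev Trace : Type := ℕ → Set ℕ

/-- `t[q ↦ t_q]`. A sequence `t_q ∈ (2^{q})^ω` is given by the predicate `i ↦ q ∈ t_q[i]`. -/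
def Trace.replace (t : Trace) (q : ℕ) (tq : ℕ → Prop) : Trace :=
  fun i => {a | (a = q ∧ tq i) ∨ (a ≠ q ∧ a ∈ t i)}

/-- `T[q ↦ t_q]`. -/
def replaceAll (T : Set Trace) (q : ℕ) (tq : ℕ → Prop) : Set Trace :=
  {t' | ∃ t ∈ T, t' = t.replace q tq}

/-- Trace assignments; the value is `none` at unassigned trace variables. -/
abbrev Assignment : Type := ℕ → Option Trace

/-- `Γ, i ⊨_T ψ` for quantifier-free `ψ`. -/
def Body.Sat (T : Set Trace) (Γ : Assignment) : ℕ → Body → Prop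
  | i, .atom a π => ∃ t, Γ π = some t ∧ a ∈ t i
  | i, .prop q => ∀ t ∈ T, q ∈ t i
  | i, .neg ψ => ¬ Body.Sat T Γ i ψ
  | i, .or ψ₁ ψ₂ => Body.Sat T Γ i ψ₁ ∨ Body.Sat T Γ i ψ₂
  | i, .next ψ => Body.Sat T Γ (i + 1) ψ
  | i, .eventually ψ => ∃ j, i ≤ j ∧ Body.Sat T Γ j ψ

/-- `Γ, i ⊨_T φ`. -/
def Formula.Sat : Set Trace → Assignment → ℕ → Formula → Prop
  | T, Γ, i, .body ψ => ψ.Sat T Γ i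
  | T, Γ, i, .allTrace π φ => ∀ t ∈ T, Formula.Sat T (Function.update Γ π (some t)) i φ
  | T, Γ, i, .exTrace π φ => ∃ t ∈ T, Formula.Sat T (Function.update Γ π (some t)) i φ
  | T, Γ, i, .allProp q φ => ∀ tq : ℕ → Prop, Formula.Sat (replaceAll T q tq) Γ i φ
  | T, Γ, i, .exProp q φ => ∃ tq : ℕ → Prop, Formula.Sat (replaceAll T q tq) Γ i φ

/-- A set of traces satisfies a formula: `∅, 0 ⊨_T φ`. -/
def Models (T : Set Trace) (φ : Formula) : Prop :=
  φ.Sat T (fun _ => none) 0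

/-! ### Well-defined formulas over `AP = I ∪ O` -/

/-- `ψ` uses only trace propositions from `AP`, trace variables from `V` and
quantified propositions from `Q`. -/
def Body.WellScoped (AP V Q : Set ℕ) : Body → Prop
  | .atom a π => a ∈ AP ∧ π ∈ V
  | .prop q => q ∈ Q
  | .neg ψ => Body.WellScoped AP V Q ψ
  | .or ψ₁ ψ₂ => Body.WellScoped AP V Q ψ₁ ∧ Body.WellScoped AP V Q ψ₂
  | .next ψ => Body.WellScoped AP V Q ψ
  | .eventually ψ => Body.WellScoped AP V Q ψ

/-- Well-definedness over inputs `I` and outputs `O` below quantifiers that bind the trace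
variables `V` and the propositions `Q`: every variable occurrence is bound, no variable is
bound twice, and quantified propositions are outputs. -/
def Formula.WellScoped (I O : Set ℕ) : Set ℕ → Set ℕ → Formula → Prop
  | V, Q, .body ψ => ψ.WellScoped (I ∪ O) V Q
  | V, Q, .allTrace π φ => π ∉ V ∧ Formula.WellScoped I O (insert π V) Q φ
  | V, Q, .exTrace π φ => π ∉ V ∧ Formula.WellScoped I O (insert π V) Q φ
  | V, Q, .allProp q φ => q ∈ O ∧ q ∉ Q ∧ Formula.WellScoped I O V (insert q Q) φ
  | V, Q, .exProp q φ => q ∈ O ∧ q ∉ Q ∧ Formula.WellScoped I O V (insert q Q) φ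

/-! ### Realizability -/

/-- Strategies `f : (2^I)^* → 2^O`. -/
abbrev Strategy (I O : Set ℕ) : Type := List (𝒫 I) → 𝒫 O

/-- The input part `w ∩ I` of a valuation. -/
def inputPart (I w : Set ℕ) : 𝒫 I := ⟨w ∩ I, Set.inter_subset_right⟩

/-- The traces `w ∈ (2^(I ∪ O))^ω` with `w ∈ f`, that is, with
`w_n ∩ O = f((w_0 ∩ I) ⋯ (w_(n-1) ∩ I))` for all `n`. -/
def Strategy.traces {I O : Set ℕ} (f : Strategy I O) : Set Trace :=
  {w | ∀ n, w n ⊆ I ∪ O ∧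
    w n ∩ O = (f ((List.range n).map fun k => inputPart I (w k)) : Set ℕ)}

/-- `φ` is realizable over inputs `I` and outputs `O`. -/
def Realizable (I O : Set ℕ) (φ : Formula) : Prop :=
  ∃ f : Strategy I O, Models f.traces φ

/-! ### Quantifier structure and fragments -/

/-- The four kinds of quantifiers. -/
inductive Quantifier : Type
  | allTrace | exTrace | allProp | exProp
  deriving DecidableEq

/-- The sequence of quantifier kinds of a formula, from the outside in. -/
def Formula.quantifiers : Formula → List Quantifier
  | .body _ => []
  | .allTrace _ φ => .allTrace :: φ.quantifiers
  | .exTrace _ φ => .exTrace :: φ.quantifiers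
  | .allProp _ φ => .allProp :: φ.quantifiers
  | .exProp _ φ => .exProp :: φ.quantifiers

/-- `∀_π` -/
def allPi : Language Quantifier := {[Quantifier.allTrace]}
/-- `∃_π` -/
def exPi : Language Quantifier := {[Quantifier.exTrace]}
/-- `∀_q` -/
def allQ : Language Quantifier := {[Quantifier.allProp]}
/-- `∃_q` -/
def exQ : Language Quantifier := {[Quantifier.exProp]}

/-- The shapes with exactly one `∀_π` quantifier (and any other quantifiers). -/
def singleAllTrace : Language Quantifier :=
  {w : List Quantifier | w.count Quantifier.allTrace = 1}

/-- The fragment `∃_{q/π}^* ∀_q^* ∀_π Q_q^*`. -/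
def tightFragment : Language Quantifier :=
  (exQ + exPi)∗ * allQ∗ * allPi * (allQ + exQ)∗

/-- The shapes with a single `∀_π` quantifier outside `∃_{q/π}^* ∀_q^* ∀_π Q_q^*`. -/
def outsideTightFragment : Language Quantifier :=
  {w : List Quantifier | w ∈ singleAllTrace ∧ w ∉ tightFragment}

/-! ### Effective numbering of formulas -/

/-- Gödel numbers of quantifier-free formulas. -/
def Body.code : Body → ℕ
  | .atom a π => 6 * Nat.pair a π
  | .prop q => 6 * q + 1
  | .neg ψ => 6 * ψ.code + 2
  | .or ψ₁ ψ₂ => 6 * Nat.pair ψ₁.code ψ₂.code + 3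
  | .next ψ => 6 * ψ.code + 4
  | .eventually ψ => 6 * ψ.code + 5

theorem Body.code_injective : Function.Injective Body.code := by
  intro x
  induction x with
  | atom a π =>
    intro y h
    cases y <;> simp [Body.code] at h <;> first | omega | skip
    simp [h]
  | prop q =>
    intro y h
    cases y <;> simp [Body.code] at h <;> first | omega | skip
    simp [h]
  | neg ψ ih =>
    intro y h
    cases y <;> simp [Body.code] at h <;> first | omega | skip
    rw [ih h]
  | or ψ₁ ψ₂ ih₁ ih₂ =>
    intro y h
    cases y <;> simp [Body.code] at h <;> first | omega | skip
    rw [ih₁ h.1, ih₂ h.2]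
  | next ψ ih =>
    intro y h
    cases y <;> simp [Body.code] at h <;> first | omega | skip
    rw [ih h]
  | eventually ψ ih =>
    intro y h
    cases y <;> simp [Body.code] at h <;> first | omega | skip
    rw [ih h]

theorem Body.code_surjective : Function.Surjective Body.code := by
  intro n
  induction n using Nat.strong_induction_on with
  | _ n ih =>
    obtain ⟨m, r, hr, rfl⟩ : ∃ m r, r < 6 ∧ n = 6 * m + r :=
      ⟨n / 6, n % 6, Nat.mod_lt _ (by norm_num), by omega⟩
    have h1 := Nat.unpair_left_le m
    have h2 := Nat.unpair_right_le m
    interval_cases r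
    · exact ⟨.atom m.unpair.1 m.unpair.2, by simp [Body.code]⟩
    · exact ⟨.prop m, rfl⟩
    · obtain ⟨x, hx⟩ := ih m (by omega)
      exact ⟨.neg x, by simp [Body.code, hx]⟩
    · obtain ⟨x, hx⟩ := ih m.unpair.1 (by omega)
      obtain ⟨y, hy⟩ := ih m.unpair.2 (by omega)
      exact ⟨.or x y, by simp [Body.code, hx, hy]⟩
    · obtain ⟨x, hx⟩ := ih m (by omega)
      exact ⟨.next x, by simp [Body.code, hx]⟩
    · obtain ⟨x, hx⟩ := ih m (by omega)
      exact ⟨.eventually x, by simp [Body.code, hx]⟩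

/-- Gödel numbers of formulas. -/
def Formula.code : Formula → ℕ
  | .body ψ => 5 * ψ.code
  | .allTrace π φ => 5 * Nat.pair π φ.code + 1
  | .exTrace π φ => 5 * Nat.pair π φ.code + 2
  | .allProp q φ => 5 * Nat.pair q φ.code + 3
  | .exProp q φ => 5 * Nat.pair q φ.code + 4

theorem Formula.code_injective : Function.Injective Formula.code := by
  intro x
  induction x with
  | body ψ =>
    intro y h
    cases y <;> simp [Formula.code] at h <;> first | omega | skip
    rw [Body.code_injective h]
  | allTrace v φ ih =>
    intro y h
    cases y <;> simp [Formula.code] at h <;> first | omega | skip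
    rw [h.1, ih h.2]
  | exTrace v φ ih =>
    intro y h
    cases y <;> simp [Formula.code] at h <;> first | omega | skip
    rw [h.1, ih h.2]
  | allProp v φ ih =>
    intro y h
    cases y <;> simp [Formula.code] at h <;> first | omega | skip
    rw [h.1, ih h.2]
  | exProp v φ ih =>
    intro y h
    cases y <;> simp [Formula.code] at h <;> first | omega | skip
    rw [h.1, ih h.2]

theorem Formula.code_surjective : Function.Surjective Formula.code := by
  intro n
  induction n using Nat.strong_induction_on with
  | _ n ih =>
    obtain ⟨m, r, hr, rfl⟩ : ∃ m r, r < 5 ∧ n = 5 * m + r :=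
      ⟨n / 5, n % 5, Nat.mod_lt _ (by norm_num), by omega⟩
    have h2 := Nat.unpair_right_le m
    interval_cases r
    · obtain ⟨x, hx⟩ := Body.code_surjective m
      exact ⟨.body x, by simp [Formula.code, hx]⟩
    all_goals obtain ⟨x, hx⟩ := ih m.unpair.2 (by omega)
    · exact ⟨.allTrace m.unpair.1 x, by simp [Formula.code, hx]⟩
    · exact ⟨.exTrace m.unpair.1 x, by simp [Formula.code, hx]⟩
    · exact ⟨.allProp m.unpair.1 x, by simp [Formula.code, hx]⟩
    · exact ⟨.exProp m.unpair.1 x, by simp [Formula.code, hx]⟩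

noncomputable instance : Denumerable Body :=
  Denumerable.mk' (Equiv.ofBijective Body.code ⟨Body.code_injective, Body.code_surjective⟩)

/-- Formulas are coded by `Formula.code`, which makes `Computable` and `ComputablePred`
available for them. -/
noncomputable instance : Denumerable Formula :=
  Denumerable.mk'
    (Equiv.ofBijective Formula.code ⟨Formula.code_injective, Formula.code_surjective⟩)

theorem Body.encode_eq (ψ : Body) : Encodable.encode ψ = ψ.code := rfl

theorem Formula.encode_eq (φ : Formula) : Encodable.encode φ = φ.code := rfl

/-! ### The decision problem -/

/-- Instances `((I, O), φ)` of the realizability problem; the finite sets `I` and `O` are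
given by lists. -/
abbrev Instance : Type := (List ℕ × List ℕ) × Formula

/-- The inputs of an instance. -/
def Instance.inputs (x : Instance) : Set ℕ := {a | a ∈ x.1.1}

/-- The outputs of an instance. -/
def Instance.outputs (x : Instance) : Set ℕ := {a | a ∈ x.1.2}

/-- `I` and `O` are disjoint and `φ` is a well-defined formula over `I ∪ O`. -/
def Instance.Valid (x : Instance) : Prop :=
  Disjoint x.inputs x.outputs ∧ x.2.WellScoped x.inputs x.outputs ∅ ∅

/-- Realizability is decidable on the formulas whose quantifier sequence lies in `C`: some
algorithm answers correctly on all valid instances with such a formula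
(its answers on other inputs do not matter). -/
def RealizabilityDecidableOn (C : Language Quantifier) : Prop :=
  ∃ P : Instance → Prop, ComputablePred P ∧
    ∀ x : Instance, x.Valid → x.2.quantifiers ∈ C →
      (P x ↔ Realizable x.inputs x.outputs x.2)

end HyperQPTL

namespace HyperQPTL

open Turing StateTransition

/-! The proof reduces non-halting to realizability. Fix a Post-Turing machine `M` with finitely many
states and symbols whose halting problem on binary inputs `n` is undecidable. There is one input
proposition, and the outputs include one proposition for each symbol of a configuration. An infinite
trace has room for a whole configuration: the two-sided tape is folded at the head, so that a move
shifts the two halves in opposite directions, which temporal logic expresses with a bounded number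
of `X` under `G`.

A strategy has a trace for every input sequence. The intended one writes the `j`-th configuration of
the run from time `j + 1` on if the input first holds at time `j`. The delay keeps the strategy
causal, and delaying the input by one leads from a configuration to its successor. The formula asks
that traces whose input holds at time 0 contain the initial configuration, and that every trace has
a successor trace to which all its configurations are passed on after one step of `M`, with a
contradiction where `M` has no step. Only the presence of symbols is demanded, so extra symbols do
no harm: a realizing strategy still yields traces containing each configuration of the run, and none
of these can be halting (`not_dom_of_successors`). Conversely, an infinite run gives the intended
strategy (`exists_strategy_written`, `stepRel_written`).

With prefix `∀π ∃π'` the successor is `π'`. With `∀q ∃q* ∀π` two traces are compared through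
propositions: `q` guesses an input sequence, the existential propositions hold a copy `u` of the
symbols of the trace with that input, and `π` is checked against `u` in two roles, as the trace to
be copied if its input is `q`, and as the successor if its input is `q` delayed by one. Since `∀π
∃π'` lies outside the tight fragment, the general claim follows by monotonicity. As `M` is fixed,
only the initial tape depends on `n`, so the formulas are primitive recursive in `n`. -/

/-! ### Finite Post-Turing machines with an undecidable halting problem -/

theorem Respects.comp {σ₁ σ₂ σ₃ : Type*} {f₁ : σ₁ → Option σ₁} {f₂ : σ₂ → Option σ₂}
    {f₃ : σ₃ → Option σ₃} {r₁ : σ₁ → σ₂ → Prop} {r₂ : σ₂ → σ₃ → Prop}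
    (h₁ : Respects f₁ f₂ r₁) (h₂ : Respects f₂ f₃ r₂) {a : σ₁} {b : σ₂} {c : σ₃}
    (hab : r₁ a b) (hbc : r₂ b c) : (eval f₃ c).Dom ↔ (eval f₁ a).Dom :=
  (tr_eval_dom h₂ hbc).trans (tr_eval_dom h₁ hab)

/-- Halting of a Post-Turing machine that is supported on a finite set of states is halting of a
machine with finitely many states. -/
theorem exists_fintype_machine {Γ Λ : Type} [Inhabited Γ] [Inhabited Λ] (M : TM0.Machine Γ Λ)
    (S : Finset Λ) (hS : TM0.Supports M (S : Set Λ)) :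
    ∃ (Q : Type) (_ : Fintype Q) (_ : Inhabited Q) (M' : TM0.Machine Γ Q), ∀ l : List Γ,
      (eval (TM0.step M') (TM0.init l)).Dom ↔ (eval (TM0.step M) (TM0.init l)).Dom := by
  classical
  let _ : Inhabited S := ⟨⟨default, hS.1⟩⟩
  let g : PointedMap Λ S :=
    ⟨fun q => if h : q ∈ S then ⟨q, h⟩ else default, dif_pos hS.1⟩
  let i : PointedMap Γ Γ := ⟨id, rfl⟩
  refine ⟨S, inferInstance, inferInstance, M.map i i g Subtype.val, fun l => ?_⟩
  have hg : ∀ q ∈ (S : Set Λ), (g q : Λ) = q := fun q hq => by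
    have : g q = ⟨q, hq⟩ := dif_pos hq
    rw [this]
  refine tr_eval_dom (TM0.Machine.map_respects M i i g Subtype.val hS (fun _ => rfl) hg) ⟨hS.1, ?_⟩
  rw [TM0.map_init]
  congr 1
  exact List.map_id l

/-- The halting problem of a multi-stack machine with finitely many reachable labels is the halting
problem of a finite Post-Turing machine. -/
theorem exists_machine_of_TM2 {K : Type} [DecidableEq K] [Fintype K] {G : K → Type}
    [∀ k, Fintype (G k)] {Λ σ : Type} [Inhabited Λ] [Inhabited σ] [Fintype σ]
    (M : Λ → TM2.Stmt G Λ σ) (S : Finset Λ) (hS : TM2.Supports M S) (k : K) :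
    ∃ (Q : Type) (_ : Fintype Q) (_ : Inhabited Q) (M' : TM0.Machine (TM2to1.Γ' K G) Q),
      ∀ l : List (G k), (eval (TM0.step M') (TM0.init (TM2to1.trInit k l))).Dom ↔
        (eval (TM2.step M) (TM2.init k l)).Dom := by
  classical
  have h₁ := TM1to0.tr_supports (TM2to1.tr M) (TM2to1.tr_supports M hS)
  obtain ⟨Q, hQ, hQ', M', h⟩ := exists_fintype_machine _ _ h₁
  refine ⟨Q, hQ, hQ', M', fun l => (h _).trans ?_⟩
  exact Respects.comp (TM2to1.tr_respects M) (TM1to0.tr_respects (TM2to1.tr M))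
    (TM2to1.trCfg_init k l) rfl

/-- Makes the input word an explicit function of `Nat.bits`, from which the initial tape can be
computed primitive recursively. -/
theorem trNat_eq_bits (n : ℕ) : PartrecToTM2.trNat n =
    n.bits.map fun b => bif b then PartrecToTM2.Γ'.bit1 else PartrecToTM2.Γ'.bit0 := by
  have h : ∀ m : PosNum, PartrecToTM2.trPosNum m = (m : ℕ).bits.map
      fun b => bif b then PartrecToTM2.Γ'.bit1 else PartrecToTM2.Γ'.bit0 := by
    intro m
    induction m with
    | one => simp [PartrecToTM2.trPosNum]
    | bit0 m ih =>
      have := PosNum.cast_pos (α := ℕ) m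
      rw [PosNum.cast_bit0, ← two_mul, Nat.bit0_bits _ (by omega)]
      simp [PartrecToTM2.trPosNum, ih]
    | bit1 m ih =>
      rw [PosNum.cast_bit1, ← two_mul, Nat.bit1_bits]
      simp [PartrecToTM2.trPosNum, ih]
  rw [PartrecToTM2.trNat]
  conv_rhs => rw [← Num.to_of_nat n]
  cases (n : Num) with
  | zero => simp [PartrecToTM2.trNum]
  | pos m => simpa [PartrecToTM2.trNum] using h m

theorem exists_nat_partrec_undecidable :
    ∃ f : ℕ →. ℕ, Partrec f ∧ ¬ ComputablePred fun n => (f n).Dom := by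
  refine ⟨fun n => (Denumerable.ofNat Nat.Partrec.Code n).eval 0, ?_, fun h => ?_⟩
  · exact Nat.Partrec.Code.eval_part.comp (Computable.ofNat _) (Computable.const 0)
  · refine ComputablePred.halting_problem 0 ?_
    refine ComputablePred.computable_of_manyOneReducible ⟨_, Computable.encode, fun c => ?_⟩ h
    simp

/-- A Post-Turing machine with finitely many states and symbols whose halting problem is
undecidable, for inputs written in binary. -/
theorem exists_undecidable_machine :
    ∃ (Q Γ : Type) (_ : Fintype Q) (_ : Fintype Γ) (_ : Inhabited Q) (_ : Inhabited Γ)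
      (M : TM0.Machine Γ Q) (a : Γ) (b : Bool → Γ), ¬ ComputablePred fun n : ℕ =>
        (eval (TM0.step M) (TM0.init (a :: (n.bits.map b).reverse))).Dom := by
  obtain ⟨f, hf, hu⟩ := exists_nat_partrec_undecidable
  obtain ⟨c, hc⟩ := ToPartrec.Code.exists_code (Nat.Partrec'.part_iff₁.2 hf)
  -- Machines start in the default label, so this instance selects the program for `c`.
  let _ : Inhabited PartrecToTM2.Λ' :=
    ⟨PartrecToTM2.trNormal c PartrecToTM2.Cont'.halt⟩
  let _ : Fintype PartrecToTM2.K' :=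
    ⟨{.main, .rev, .aux, .stack}, fun k => by cases k <;> simp⟩
  obtain ⟨Q, hQ, hQ', M, hM⟩ := exists_machine_of_TM2 PartrecToTM2.tr
    (PartrecToTM2.codeSupp c PartrecToTM2.Cont'.halt)
    (PartrecToTM2.tr_supports c PartrecToTM2.Cont'.halt) PartrecToTM2.K'.main
  let sym : PartrecToTM2.Γ' → ∀ _ : PartrecToTM2.K', Option PartrecToTM2.Γ' :=
    fun x => Function.update (fun _ => none) PartrecToTM2.K'.main (some x)
  -- `trInit` reverses the stack and marks its bottom cell by `true`. The bottom symbol is the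
  -- `cons` that ends `trList [n]`.
  refine ⟨Q, _, hQ, inferInstance, hQ', inferInstance, M, (true, sym .cons),
    fun b => (false, sym (bif b then .bit1 else .bit0)), fun h => hu (h.of_eq fun n => ?_)⟩
  have h₁ := hM (PartrecToTM2.trList [n])
  have h₂ : TM2to1.trInit (Γ := fun _ : PartrecToTM2.K' => PartrecToTM2.Γ') PartrecToTM2.K'.main
      (PartrecToTM2.trList [n]) = (true, sym .cons) :: (n.bits.map
        fun b => (false, sym (bif b then .bit1 else .bit0))).reverse := by
    have h : PartrecToTM2.trList [n] = (.cons :: n.bits.reverse.map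
        fun b => bif b then PartrecToTM2.Γ'.bit1 else PartrecToTM2.Γ'.bit0).reverse := by
      simp [trNat_eq_bits]
    rw [h, TM2to1.trInit, List.reverse_reverse, ← List.map_reverse]
    change (true, sym .cons) :: List.map (fun a => (false, sym a)) (List.map _ n.bits.reverse) = _
    rw [List.map_map]
    rfl
  have h₃ : TM2.init PartrecToTM2.K'.main (PartrecToTM2.trList [n]) = PartrecToTM2.init c [n] := by
    unfold TM2.init PartrecToTM2.init
    congr 1
    funext k
    cases k <;> rfl
  rw [h₂, h₃, PartrecToTM2.tr_eval] at h₁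
  refine h₁.trans ?_
  have h₄ := hc ⟨[n], rfl⟩
  simp only at h₄
  rw [h₄]
  simp [List.Vector.head]

/-! ### Derived operators -/

namespace Body

/-- Implication. -/
def imp (ψ₁ ψ₂ : Body) : Body := .or (.neg ψ₁) ψ₂
/-- Conjunction. -/
def and (ψ₁ ψ₂ : Body) : Body := .neg (.or (.neg ψ₁) (.neg ψ₂))
/-- The temporal operator "globally". -/
def glob (ψ : Body) : Body := .neg (.eventually (.neg ψ))
/-- Equivalence. -/
def iff (ψ₁ ψ₂ : Body) : Body := and (imp ψ₁ ψ₂) (imp ψ₂ ψ₁)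
/-- Conjunction of a family indexed by a finite type; `tt` is a tautology that is used as the
empty conjunction. -/
noncomputable def conj {α : Type} [Fintype α] (tt : Body) (f : α → Body) : Body :=
  (Finset.univ.toList.map f).foldr and (.or tt (.neg tt))
/-- `X^n ψ` -/
def nexts (n : ℕ) (ψ : Body) : Body := Body.next^[n] ψ

variable {T : Set Trace} {Γ : Assignment} {i : ℕ} {ψ ψ₁ ψ₂ : Body} {AP V Q : Set ℕ}

@[simp] theorem sat_prop {q : ℕ} : Body.Sat T Γ i (.prop q) ↔ ∀ t ∈ T, q ∈ t i := by
  rw [Body.Sat]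

@[simp] theorem sat_neg : Body.Sat T Γ i (.neg ψ) ↔ ¬ Body.Sat T Γ i ψ := by rw [Body.Sat]

@[simp] theorem sat_or :
    Body.Sat T Γ i (.or ψ₁ ψ₂) ↔ Body.Sat T Γ i ψ₁ ∨ Body.Sat T Γ i ψ₂ := by rw [Body.Sat]

@[simp] theorem sat_next : Body.Sat T Γ i (.next ψ) ↔ Body.Sat T Γ (i + 1) ψ := by rw [Body.Sat]

@[simp] theorem sat_imp :
    Body.Sat T Γ i (imp ψ₁ ψ₂) ↔ (Body.Sat T Γ i ψ₁ → Body.Sat T Γ i ψ₂) := by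
  simp [imp, imp_iff_not_or]

@[simp] theorem sat_and :
    Body.Sat T Γ i (and ψ₁ ψ₂) ↔ (Body.Sat T Γ i ψ₁ ∧ Body.Sat T Γ i ψ₂) := by
  simp [and]

@[simp] theorem sat_iff :
    Body.Sat T Γ i (iff ψ₁ ψ₂) ↔ (Body.Sat T Γ i ψ₁ ↔ Body.Sat T Γ i ψ₂) := by
  simp [iff, iff_iff_implies_and_implies]

@[simp] theorem sat_glob :
    Body.Sat T Γ i (glob ψ) ↔ ∀ k, Body.Sat T Γ (i + k) ψ := by
  simp only [glob, Body.Sat, not_exists, not_and, not_not]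
  refine ⟨fun h k => h _ (Nat.le_add_right i k), fun h j hj => ?_⟩
  obtain ⟨k, rfl⟩ := Nat.exists_eq_add_of_le hj
  exact h k

@[simp] theorem sat_conj {α : Type} [Fintype α] {tt : Body} {f : α → Body} :
    Body.Sat T Γ i (conj tt f) ↔ ∀ a, Body.Sat T Γ i (f a) := by
  have h : ∀ l : List α, Body.Sat T Γ i ((l.map f).foldr and (.or tt (.neg tt))) ↔
      ∀ a ∈ l, Body.Sat T Γ i (f a) := by
    intro l
    induction l with
    | nil => simp [em]
    | cons a l ih => simp [ih]
  simp [conj, h]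

@[simp] theorem sat_nexts {n : ℕ} : Body.Sat T Γ i (nexts n ψ) ↔ Body.Sat T Γ (i + n) ψ := by
  induction n generalizing i with
  | zero => rfl
  | succ n ih =>
    rw [nexts, Function.iterate_succ_apply', sat_next, ← nexts, ih, add_right_comm, add_assoc]

@[simp] theorem wellScoped_neg : (Body.neg ψ).WellScoped AP V Q ↔ ψ.WellScoped AP V Q := Iff.rfl

@[simp] theorem wellScoped_or : (Body.or ψ₁ ψ₂).WellScoped AP V Q ↔
    ψ₁.WellScoped AP V Q ∧ ψ₂.WellScoped AP V Q := Iff.rfl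

@[simp] theorem wellScoped_next : (Body.next ψ).WellScoped AP V Q ↔ ψ.WellScoped AP V Q := Iff.rfl

@[simp] theorem wellScoped_imp : (imp ψ₁ ψ₂).WellScoped AP V Q ↔
    ψ₁.WellScoped AP V Q ∧ ψ₂.WellScoped AP V Q := Iff.rfl

@[simp] theorem wellScoped_and : (and ψ₁ ψ₂).WellScoped AP V Q ↔
    ψ₁.WellScoped AP V Q ∧ ψ₂.WellScoped AP V Q := Iff.rfl

@[simp] theorem wellScoped_iff : (iff ψ₁ ψ₂).WellScoped AP V Q ↔
    ψ₁.WellScoped AP V Q ∧ ψ₂.WellScoped AP V Q := by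
  simp only [iff, wellScoped_and, wellScoped_imp]
  tauto

@[simp] theorem wellScoped_glob : (glob ψ).WellScoped AP V Q ↔ ψ.WellScoped AP V Q := Iff.rfl

@[simp] theorem wellScoped_nexts {n : ℕ} :
    (nexts n ψ).WellScoped AP V Q ↔ ψ.WellScoped AP V Q := by
  induction n with
  | zero => rfl
  | succ n ih => rw [nexts, Function.iterate_succ_apply', wellScoped_next, ← nexts, ih]

theorem wellScoped_conj {α : Type} [Fintype α] {tt : Body} {f : α → Body}
    (ht : tt.WellScoped AP V Q) (hf : ∀ a, (f a).WellScoped AP V Q) :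
    (conj tt f).WellScoped AP V Q := by
  unfold conj
  induction (Finset.univ : Finset α).toList with
  | nil => simp [ht]
  | cons a l ih => simpa [hf] using ih

end Body

/-! ### Machine configurations on traces -/

section Machine

set_option linter.unusedSectionVars false

variable {Q Γ : Type} [Inhabited Q] [Inhabited Γ]

/-- The symbols that describe a machine configuration: a control state, a symbol on the part of
the tape from the head to the right, or a symbol on the part strictly left of the head. -/
abbrev Sym (Q Γ : Type) : Type := Q ⊕ (Γ ⊕ Γ)

/-- The symbol for a control state. -/
abbrev Sym.state (q : Q) : Sym Q Γ := .inl q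
/-- The symbol for a tape cell at or right of the head. -/
abbrev Sym.right (a : Γ) : Sym Q Γ := .inr (.inl a)
/-- The symbol for a tape cell left of the head. -/
abbrev Sym.left (a : Γ) : Sym Q Γ := .inr (.inr a)

/-- Sequences of sets of symbols. -/
abbrev Track (Q Γ : Type) : Type := ℕ → Sym Q Γ → Prop

/-- The configuration `c` written as a sequence: the control state is given at position `0` only,
position `k` holds the tape symbols at distance `k` to the right and `k + 1` to the left. -/
def content (c : TM0.Cfg Γ Q) : Track Q Γ := fun k b =>
  match b with
  | .inl q => k = 0 ∧ c.q = q
  | .inr (.inl a) => c.Tape.nth k = a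
  | .inr (.inr a) => c.Tape.nth (-(k + 1 : ℤ)) = a

/-- `u` contains the configuration `c` from position `t` on. -/
def Contains (u : Track Q Γ) (t : ℕ) (c : TM0.Cfg Γ Q) : Prop :=
  ∀ k b, content c k b → u (t + k) b

/-- The symbols `f a` that `u` has from `t + m` on are in `v` from `t + n` on. -/
def Transfer (u v : Track Q Γ) (t m n : ℕ) (f : Γ → Sym Q Γ) : Prop :=
  ∀ k a, u (t + k + m) (f a) → v (t + k + n) (f a)

/-- The effect of reading `a` and executing a machine statement at position `t`. -/
def StmtRel (u v : Track Q Γ) (t : ℕ) (a : Γ) : TM0.Stmt Γ → Prop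
  | .move .right => Transfer u v t 1 1 Sym.right ∧ Transfer u v t 0 2 Sym.left ∧
      v (t + 1) (Sym.left a)
  | .move .left => Transfer u v t 0 2 Sym.right ∧ Transfer u v t 1 1 Sym.left ∧
      ∀ b, u t (Sym.left b) → v (t + 1) (Sym.right b)
  | .write b => Transfer u v t 1 2 Sym.right ∧ Transfer u v t 0 1 Sym.left ∧
      v (t + 1) (Sym.right b)

/-- What `M` does in state `q` when reading `a` at position `t`. -/
def RuleRel (M : TM0.Machine Γ Q) (u v : Track Q Γ) (t : ℕ) (q : Q) (a : Γ) : Prop :=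
  match M q a with
  | none => False
  | some (q', s) => v (t + 1) (Sym.state q') ∧ StmtRel u v t a s

/-- Whenever `u` contains a configuration, `v` contains the next one, one position later. -/
def StepRel (M : TM0.Machine Γ Q) (u v : Track Q Γ) : Prop :=
  ∀ t q a, u t (Sym.state q) → u t (Sym.right a) → RuleRel M u v t q a

/-- A contained configuration shows its state and scanned symbol at `t`, so a rule fires there. The
rule is `False` if `M` has no step, hence a step exists. -/
theorem StepRel.contains {M : TM0.Machine Γ Q} {u v : Track Q Γ} (h : StepRel M u v) {t : ℕ}
    {c : TM0.Cfg Γ Q} (hc : Contains u t c) :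
    ∃ c', TM0.step M c = some c' ∧ Contains v (t + 1) c' := by
  obtain ⟨q, T⟩ := c
  have h₁ := h t q (T.nth 0) (hc 0 (Sym.state q) ⟨rfl, rfl⟩) (hc 0 (Sym.right _) rfl)
  have hr : ∀ k : ℕ, u (t + k) (Sym.right (T.nth k)) := fun k => hc k (Sym.right _) rfl
  have hl : ∀ k : ℕ, u (t + k) (Sym.left (T.nth (-(k + 1 : ℤ)))) :=
    fun k => hc k (Sym.left _) rfl
  rw [Tape.nth_zero] at h₁
  unfold RuleRel at h₁
  simp only [TM0.step]
  rcases hM : M q T.head with _ | ⟨q', s⟩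
  · rw [hM] at h₁
    exact h₁.elim
  rw [hM] at h₁
  refine ⟨_, rfl, ?_⟩
  obtain ⟨hq, hs⟩ := h₁
  rintro k (p | a | a) hb
  · obtain ⟨rfl, rfl⟩ := hb
    exact hq
  all_goals
    -- The whole configuration moves one position later. Hence a half tape is shifted by 1 if it
    -- keeps its length, by 0 if it loses its nearest cell and by 2 if it gains one; the new or
    -- rewritten cell is given by the third condition.
    rcases s with (_ | _) | b
    all_goals
      obtain ⟨h₁, h₂, h₃⟩ := hs
      simp only [content] at hb
      subst hb
  · rcases k with _ | k
    · rw [Tape.move_left_nth]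
      simpa using h₃ _ (hl 0)
    · have := h₁ k _ (hr k)
      simpa [add_assoc, add_comm, add_left_comm] using this
  · have := h₁ k _ (by simpa [add_assoc] using hr (k + 1))
    simpa [add_assoc, add_comm, add_left_comm] using this
  · rcases k with _ | k
    · rw [Tape.write_nth]
      simpa using h₃
    · have := h₁ k _ (by simpa [add_assoc] using hr (k + 1))
      rw [Tape.write_nth, if_neg (by omega)]
      simpa [add_assoc, add_comm, add_left_comm] using this
  · rw [Tape.move_left_nth, show t + 1 + k = t + k + 1 by omega,
      show -(k + 1 : ℤ) - 1 = -((k + 1 : ℕ) + 1 : ℤ) by push_cast; ring]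
    exact h₂ k _ (hl (k + 1))
  · rcases k with _ | k
    · simpa using h₃
    · rw [Tape.move_right_nth, show t + 1 + (k + 1) = t + k + 2 by omega,
        show -((k + 1 : ℕ) + 1 : ℤ) + 1 = -(k + 1 : ℤ) by push_cast; ring]
      exact h₂ k _ (hl k)
  · have := h₂ k _ (hl k)
    rw [Tape.write_nth, if_neg (by omega)]
    convert this using 1
    omega

/-- The configuration `c` written from position `t` on, and nothing else. -/
def shifted (t : ℕ) (c : TM0.Cfg Γ Q) : Track Q Γ := fun n b => ∃ k, n = t + k ∧ content c k b

theorem shifted_add (t k : ℕ) (c : TM0.Cfg Γ Q) (b : Sym Q Γ) :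
    shifted t c (t + k) b ↔ content c k b :=
  ⟨fun ⟨j, hj, h⟩ => by rwa [Nat.add_left_cancel hj], fun h => ⟨k, rfl, h⟩⟩

/-- A state symbol occurs in `shifted t c` at position `t` only, so no rule other than the one for
the actual step can fire. -/
theorem stepRel_shifted {M : TM0.Machine Γ Q} {c c' : TM0.Cfg Γ Q} (h : TM0.step M c = some c')
    (t : ℕ) : StepRel M (shifted t c) (shifted (t + 1) c') := by
  rintro n q a ⟨k, rfl, rfl, rfl⟩ ha
  rw [shifted_add] at ha
  obtain ⟨q, T⟩ := c
  simp only [content, Nat.cast_zero, Tape.nth_zero] at ha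
  subst ha
  unfold RuleRel
  simp only [TM0.step] at h
  rcases hM : M q T.head with _ | ⟨q', s⟩
  · simp [hM] at h
  simp only [hM, Option.map_some, Option.some.injEq] at h
  subst h
  have e : ∀ k, t + 0 + k + 1 = t + 1 + k := fun k => by omega
  have e' : ∀ k, t + 0 + k + 2 = t + 1 + (k + 1) := fun k => by omega
  have e₁ : ∀ k, t + 0 + k + 1 = t + (k + 1) := fun k => by omega
  have e₀ : t + 0 + 1 = t + 1 + 0 := by omega
  refine ⟨⟨0, rfl, rfl, rfl⟩, ?_⟩
  rcases s with (_ | _) | b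
  all_goals refine ⟨fun k a h => ?_, fun k a h => ?_, ?_⟩
  · rw [add_zero, add_zero, shifted_add] at h
    rw [e', shifted_add]
    simpa [content] using h
  · rw [e₁, shifted_add] at h
    rw [e, shifted_add]
    simp only [content, Tape.move_left_nth] at h ⊢
    rw [← h]
    congr 1
  · intro b h
    rw [shifted_add] at h
    rw [e₀, shifted_add]
    simp only [content, Tape.move_left_nth] at h ⊢
    simpa using h
  · rw [e₁, shifted_add] at h
    rw [e, shifted_add]
    simpa [content] using h
  · rw [add_zero, add_zero, shifted_add] at h
    rw [e', shifted_add]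
    simp only [content, Tape.move_right_nth] at h ⊢
    rw [← h]
    congr 1
  · rw [e₀, shifted_add]
    simp [content]
  · rw [e₁, shifted_add] at h
    rw [e', shifted_add]
    simp only [content] at h ⊢
    rw [Tape.write_nth, if_neg (by omega)]
    exact h
  · rw [add_zero, add_zero, shifted_add] at h
    rw [e, shifted_add]
    simp only [content] at h ⊢
    rw [Tape.write_nth, if_neg (by omega)]
    exact h
  · rw [e₀, shifted_add]
    simp [content, Tape.write]

theorem stepRel_of_forall_not {M : TM0.Machine Γ Q} {u v : Track Q Γ} (h : ∀ t b, ¬ u t b) :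
    StepRel M u v := fun _ _ _ h' => (h _ _ h').elim

/-! ### The same in temporal logic -/

variable [Fintype Q] [Fintype Γ]

/-- The formula for `Transfer`. -/
noncomputable def transferBody (tt : Body) (A B : Sym Q Γ → Body) (m n : ℕ) (f : Γ → Sym Q Γ) :
    Body :=
  .glob (.conj tt fun a => .imp (.nexts m (A (f a))) (.nexts n (B (f a))))

/-- The formula for `StmtRel`. -/
noncomputable def stmtBody (tt : Body) (A B : Sym Q Γ → Body) (a : Γ) : TM0.Stmt Γ → Body
  | .move .right => .and (transferBody tt A B 1 1 Sym.right)
      (.and (transferBody tt A B 0 2 Sym.left) (.next (B (Sym.left a))))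
  | .move .left => .and (transferBody tt A B 0 2 Sym.right)
      (.and (transferBody tt A B 1 1 Sym.left)
        (.conj tt fun b => .imp (A (Sym.left b)) (.next (B (Sym.right b)))))
  | .write b => .and (transferBody tt A B 1 2 Sym.right)
      (.and (transferBody tt A B 0 1 Sym.left) (.next (B (Sym.right b))))

/-- The formula for `RuleRel`. -/
noncomputable def ruleBody (M : TM0.Machine Γ Q) (tt : Body) (A B : Sym Q Γ → Body) (q : Q)
    (a : Γ) : Body :=
  match M q a with
  | none => .neg (.or tt (.neg tt))
  | some (q', s) => .and (.next (B (Sym.state q'))) (stmtBody tt A B a s)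

/-- The formula for `StepRel`. -/
noncomputable def stepBody (M : TM0.Machine Γ Q) (tt : Body) (A B : Sym Q Γ → Body) : Body :=
  .glob (.conj tt fun q => .conj tt fun a =>
    .imp (A (Sym.state q)) (.imp (A (Sym.right a)) (ruleBody M tt A B q a)))

section Sat

variable {T : Set Trace} {G : Assignment} {A B : Sym Q Γ → Body} {u v : Track Q Γ}

theorem sat_transferBody (hA : ∀ t b, Body.Sat T G t (A b) ↔ u t b)
    (hB : ∀ t b, Body.Sat T G t (B b) ↔ v t b) (tt : Body) (t m n : ℕ) (f : Γ → Sym Q Γ) :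
    Body.Sat T G t (transferBody tt A B m n f) ↔ Transfer u v t m n f := by
  simp [transferBody, Transfer, hA, hB]

/-- The bodies `A` and `B` are arbitrary, so that a configuration may be read off a trace or off
quantified propositions. -/
theorem sat_stepBody (hA : ∀ t b, Body.Sat T G t (A b) ↔ u t b)
    (hB : ∀ t b, Body.Sat T G t (B b) ↔ v t b) (M : TM0.Machine Γ Q) (tt : Body) :
    Body.Sat T G 0 (stepBody M tt A B) ↔ StepRel M u v := by
  have hs : ∀ t a s, Body.Sat T G t (stmtBody tt A B a s) ↔ StmtRel u v t a s := by
    rintro t a ((_ | _) | b) <;>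
      simp [stmtBody, StmtRel, sat_transferBody hA hB, hA, hB]
  have hr : ∀ t q a, Body.Sat T G t (ruleBody M tt A B q a) ↔ RuleRel M u v t q a := by
    intro t q a
    unfold ruleBody RuleRel
    rcases M q a with _ | ⟨q', s⟩
    · simp [em]
    · simp [hs, hB]
  simp only [stepBody, Body.sat_glob, Body.sat_conj, Body.sat_imp, hA, hr, zero_add, StepRel]

end Sat

theorem wellScoped_stepBody {AP V P : Set ℕ} {A B : Sym Q Γ → Body} {tt : Body}
    (ht : tt.WellScoped AP V P) (hA : ∀ b, (A b).WellScoped AP V P)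
    (hB : ∀ b, (B b).WellScoped AP V P) (M : TM0.Machine Γ Q) :
    (stepBody M tt A B).WellScoped AP V P := by
  have h : ∀ m n f, (transferBody tt A B m n f).WellScoped AP V P := fun m n f =>
    Body.wellScoped_glob.2 (Body.wellScoped_conj ht fun a => by simp [hA, hB])
  have hs : ∀ a s, (stmtBody tt A B a s).WellScoped AP V P := by
    rintro a ((_ | _) | b)
    · exact ⟨h _ _ _, h _ _ _, Body.wellScoped_conj ht fun b => by simp [hA, hB]⟩
    · exact ⟨h _ _ _, h _ _ _, hB _⟩
    · exact ⟨h _ _ _, h _ _ _, hB _⟩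
  refine Body.wellScoped_glob.2 (Body.wellScoped_conj ht fun q =>
    Body.wellScoped_conj ht fun a => ⟨hA _, hA _, ?_⟩)
  unfold ruleBody
  rcases M q a with _ | ⟨q', s⟩
  · exact ⟨ht, ht⟩
  · exact ⟨hB _, hs _ _⟩

/-- The formula for a right part of a tape. -/
def tapeBody (A : Sym Q Γ → Body) (l : List Γ) : Body :=
  l.foldr (fun a φ => .and (A (Sym.right a)) (.next φ)) (.glob (A (Sym.right default)))

/-- The formula for the initial configuration on the tape `l`. -/
def startBody (A : Sym Q Γ → Body) (l : List Γ) : Body :=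
  .and (A (Sym.state default)) (.and (.glob (A (Sym.left default))) (tapeBody A l))

theorem sat_tapeBody {T : Set Trace} {G : Assignment} {A : Sym Q Γ → Body} {u : Track Q Γ}
    (hA : ∀ t b, Body.Sat T G t (A b) ↔ u t b) (t : ℕ) (l : List Γ) :
    Body.Sat T G t (tapeBody A l) ↔ ∀ k, u (t + k) (Sym.right (l.getI k)) := by
  induction l generalizing t with
  | nil => simp [tapeBody, hA]
  | cons a l ih =>
    rw [tapeBody, List.foldr_cons, ← tapeBody, Body.sat_and, Body.sat_next, ih, hA]
    refine ⟨fun h k => ?_, fun h => ⟨h 0, fun k => ?_⟩⟩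
    · rcases k with _ | k
      · exact h.1
      · simpa [add_assoc, add_comm, add_left_comm] using h.2 k
    · simpa [add_assoc, add_comm, add_left_comm] using h (k + 1)

theorem sat_startBody {T : Set Trace} {G : Assignment} {A : Sym Q Γ → Body} {u : Track Q Γ}
    (hA : ∀ t b, Body.Sat T G t (A b) ↔ u t b) (t : ℕ) (l : List Γ) :
    Body.Sat T G t (startBody A l) ↔ Contains u t (TM0.init l) := by
  have hr : ∀ k : ℕ, (TM0.init l : TM0.Cfg Γ Q).Tape.nth k = l.getI k := fun k => by
    simp [TM0.init, Tape.mk₁, Tape.mk₂]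
  have hl : ∀ k : ℕ, (TM0.init l : TM0.Cfg Γ Q).Tape.nth (-(k + 1 : ℤ)) = default := fun k => by
    have : (-(k + 1 : ℤ)) = Int.negSucc k := by omega
    rw [this]
    simp [TM0.init, Tape.mk₁, Tape.mk₂, Tape.nth]
  rw [startBody, Body.sat_and, Body.sat_and, Body.sat_glob, sat_tapeBody hA]
  simp only [hA]
  constructor
  · rintro ⟨h₁, h₂, h₃⟩ k (q | a | a) hb
    · obtain ⟨rfl, rfl⟩ := hb
      exact h₁
    · simp only [content, hr] at hb
      exact hb ▸ h₃ k
    · simp only [content, hl] at hb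
      exact hb ▸ h₂ k
  · intro h
    exact ⟨h 0 (Sym.state default) ⟨rfl, rfl⟩, fun k => h k (Sym.left default) (hl k),
      fun k => h k (Sym.right (l.getI k)) (hr k)⟩

theorem wellScoped_startBody {AP V P : Set ℕ} {A : Sym Q Γ → Body}
    (hA : ∀ b, (A b).WellScoped AP V P) (l : List Γ) :
    (startBody A l).WellScoped AP V P := by
  refine ⟨hA _, hA _, ?_⟩
  change (tapeBody A l).WellScoped AP V P
  induction l with
  | nil => exact hA _
  | cons a l ih => exact ⟨hA _, ih⟩

end Machine

/-! ### Strategies and their traces -/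

/-- Every input sequence occurs on some trace of a strategy. -/
theorem Strategy.exists_mem_traces {I O : Set ℕ} (h : Disjoint I O) (f : Strategy I O)
    (X : ℕ → 𝒫 I) : ∃ w ∈ f.traces, ∀ n, inputPart I (w n) = X n := by
  let w : Trace := fun n => (X n : Set ℕ) ∪ (f ((List.range n).map X) : Set ℕ)
  have hI : ∀ n, inputPart I (w n) = X n := by
    intro n
    have h₁ := (X n).2
    have h₂ := (f ((List.range n).map X)).2
    ext a
    constructor
    · rintro ⟨ha | ha, ha'⟩
      · exact ha
      · exact (Set.disjoint_left.1 h ha' (h₂ ha)).elim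
    · exact fun ha => ⟨Or.inl ha, h₁ ha⟩
  refine ⟨w, fun n => ?_, hI⟩
  have h₁ := (X n).2
  have h₂ := (f ((List.range n).map X)).2
  simp only [hI]
  refine ⟨Set.union_subset_union h₁ h₂, ?_⟩
  ext a
  constructor
  · rintro ⟨ha | ha, ha'⟩
    · exact (Set.disjoint_left.1 h (h₁ ha) ha').elim
    · exact ha
  · exact fun ha => ⟨Or.inr ha, h₂ ha⟩

/-- A causal map from input sequences to output sequences is implemented by a strategy. -/
theorem exists_strategy {I O : Set ℕ} (out : (ℕ → 𝒫 I) → ℕ → 𝒫 O)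
    (h : ∀ X Y n, (∀ k < n, X k = Y k) → out X n = out Y n) :
    ∃ f : Strategy I O, ∀ w ∈ f.traces, ∀ n,
      w n ∩ O = (out (fun k => inputPart I (w k)) n : Set ℕ) := by
  -- Padding beyond the known history; by causality its choice is irrelevant.
  let e : 𝒫 I := ⟨∅, Set.mem_powerset (Set.empty_subset _)⟩
  refine ⟨fun l => out (fun k => l.getD k e) l.length, fun w hw n => ?_⟩
  rw [(hw n).2]
  simp only [List.length_map, List.length_range]
  congr 1
  refine h _ _ n fun k hk => ?_
  simp [List.getD, hk]

/-! ### Runs of machines -/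

section Run

variable {σ : Type*} {step : σ → Option σ}

/-- Iterate `step`, staying put when it is undefined. This fallback is never used, since a reachable
configuration without a step would be a halting one. -/
theorem exists_run_of_not_dom {a : σ} (h : ¬ (eval step a).Dom) :
    ∃ c : ℕ → σ, c 0 = a ∧ ∀ n, step (c n) = some (c (n + 1)) := by
  let c : ℕ → σ := fun n => (fun c => (step c).getD c)^[n] a
  have hs : ∀ n, c (n + 1) = (step (c n)).getD (c n) := fun n =>
    Function.iterate_succ_apply' _ n a
  have hr : ∀ n, Reaches step a (c n) → step (c n) = some (c (n + 1)) := by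
    intro n hr
    rw [hs]
    rcases e : step (c n) with _ | c'
    · exact (h (Part.dom_iff_mem.2 ⟨_, mem_eval.2 ⟨hr, e⟩⟩)).elim
    · rfl
  have hc : ∀ n, Reaches step a (c n) := by
    intro n
    induction n with
    | zero => exact .refl
    | succ n ih => exact ih.tail (hr n ih)
  exact ⟨c, rfl, fun n => hr n (hc n)⟩

end Run

/-! ### Propositions of the reduction and traces that write a run -/

section Reduction

set_option linter.unusedSectionVars false

variable {Q Γ : Type} [Fintype Q] [Fintype Γ] [Inhabited Q] [Inhabited Γ]

/-- The output proposition for a symbol. -/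
noncomputable def symNum (b : Sym Q Γ) : ℕ := 2 * (Fintype.equivFin (Sym Q Γ) b : ℕ) + 2

/-- A second proposition for a symbol. -/
noncomputable def copyNum (b : Sym Q Γ) : ℕ := 2 * (Fintype.equivFin (Sym Q Γ) b : ℕ) + 3

theorem symNum_injective : Function.Injective (symNum : Sym Q Γ → ℕ) := by
  intro b c h
  simpa [symNum, Fin.val_inj] using h

theorem copyNum_injective : Function.Injective (copyNum : Sym Q Γ → ℕ) := by
  intro b c h
  simpa [copyNum, Fin.val_inj] using h

theorem symNum_ne_copyNum (b c : Sym Q Γ) : symNum b ≠ copyNum c := by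
  unfold symNum copyNum
  omega

variable (Q Γ) in
/-- The output propositions: a quantified copy of the input, and two propositions for each
symbol. -/
def outputList : List ℕ := (List.range (2 * Fintype.card (Sym Q Γ) + 1)).map (· + 1)

theorem mem_outputList {a : ℕ} :
    a ∈ outputList Q Γ ↔ 1 ≤ a ∧ a ≤ 2 * Fintype.card (Sym Q Γ) + 1 := by
  simp only [outputList, List.mem_map, List.mem_range]
  exact ⟨by rintro ⟨b, hb, rfl⟩; omega, fun h => ⟨a - 1, by omega, by omega⟩⟩

theorem symNum_mem (b : Sym Q Γ) : symNum b ∈ outputList Q Γ := by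
  have := (Fintype.equivFin (Sym Q Γ) b).2
  rw [mem_outputList, symNum]
  omega

theorem copyNum_mem (b : Sym Q Γ) : copyNum b ∈ outputList Q Γ := by
  have := (Fintype.equivFin (Sym Q Γ) b).2
  rw [mem_outputList, copyNum]
  omega

/-- The input propositions. -/
abbrev inputSet : Set ℕ := {a | a ∈ [0]}

variable (Q Γ) in
/-- The output propositions as a set. -/
abbrev outputSet : Set ℕ := {a | a ∈ outputList Q Γ}

theorem disjoint_inputSet_outputSet : Disjoint inputSet (outputSet Q Γ) := by
  rw [Set.disjoint_left]
  intro a ha hb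
  simp only [List.mem_singleton, Set.mem_ofPred_eq] at ha
  rw [Set.mem_ofPred_eq, mem_outputList] at hb
  omega

/-- The symbols that occur on a trace. -/
def track (w : Trace) : Track Q Γ := fun n b => symNum b ∈ w n

theorem exists_mem_traces_of_input (f : Strategy inputSet (outputSet Q Γ)) (x : ℕ → Prop) :
    ∃ w ∈ f.traces, ∀ n, 0 ∈ w n ↔ x n := by
  obtain ⟨w, hw, h⟩ := f.exists_mem_traces disjoint_inputSet_outputSet
    (fun n => ⟨{a | a ∈ [0] ∧ x n}, fun a ha => ha.1⟩)
  refine ⟨w, hw, fun n => ?_⟩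
  have := congrArg (fun s : 𝒫 inputSet => 0 ∈ (s : Set ℕ)) (h n)
  simpa [inputPart] using this

/-- If the first input occurs at time `j`, then the `j`-th configuration is written from time
`j + 1` on. -/
def written (c : ℕ → TM0.Cfg Γ Q) (x : ℕ → Prop) : Track Q Γ := fun n b =>
  ∃ j, x j ∧ (∀ i < j, ¬ x i) ∧ shifted (j + 1) (c j) n b

theorem written_eq_shifted {c : ℕ → TM0.Cfg Γ Q} {x : ℕ → Prop} {j : ℕ} (hj : x j)
    (hi : ∀ i < j, ¬ x i) : written c x = shifted (j + 1) (c j) := by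
  funext n b
  refine propext ⟨?_, fun h => ⟨j, hj, hi, h⟩⟩
  rintro ⟨j', hj', hi', h⟩
  obtain rfl : j' = j := by
    by_contra hne
    rcases Nat.lt_or_gt_of_ne hne with hlt | hlt
    · exact hi _ hlt hj'
    · exact hi' _ hlt hj
  exact h

/-- Here `y` is `x` delayed by one, so a first occurrence at `j` becomes one at `j + 1`, and `c j`
from `j + 1` on becomes `c (j + 1)` from `j + 2` on. If `x` never holds, nothing is written. -/
theorem stepRel_written {M : TM0.Machine Γ Q} {c : ℕ → TM0.Cfg Γ Q}
    (hc : ∀ n, TM0.step M (c n) = some (c (n + 1))) {x y : ℕ → Prop} (h₀ : ¬ y 0)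
    (h : ∀ n, x n ↔ y (n + 1)) : StepRel M (written c x) (written c y) := by
  classical
  by_cases hx : ∃ j, x j
  · have hj := Nat.find_spec hx
    have hi : ∀ i < Nat.find hx, ¬ x i := fun i hi => Nat.find_min hx hi
    have hi' : ∀ i < Nat.find hx + 1, ¬ y i := by
      rintro (_ | i) hlt
      · exact h₀
      · rw [← h]
        exact hi i (by omega)
    rw [written_eq_shifted hj hi, written_eq_shifted ((h _).1 hj) hi']
    exact stepRel_shifted (hc _) _
  · push Not at hx
    refine stepRel_of_forall_not ?_
    rintro t b ⟨j, hj, -⟩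
    exact hx j hj

/-- A symbol written at time `n` stems from some `j` with `j + 1 ≤ n`, so it depends on inputs
before `n` only. This is why configurations start at `j + 1` and not at `j`. -/
theorem exists_strategy_written (c : ℕ → TM0.Cfg Γ Q) :
    ∃ f : Strategy inputSet (outputSet Q Γ), ∀ w ∈ f.traces,
      track w = written c fun n => 0 ∈ w n := by
  obtain ⟨f, hf⟩ := exists_strategy (I := inputSet) (O := outputSet Q Γ)
    (fun X n => ⟨{a | ∃ b : Sym Q Γ, a = symNum b ∧ written c (fun k => 0 ∈ (X k : Set ℕ)) n b},
      by rintro a ⟨b, rfl, -⟩; exact symNum_mem b⟩) (by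
      have key : ∀ X Y : ℕ → 𝒫 inputSet, ∀ n, (∀ k < n, X k = Y k) → ∀ b : Sym Q Γ,
          written c (fun k => 0 ∈ (X k : Set ℕ)) n b →
          written c (fun k => 0 ∈ (Y k : Set ℕ)) n b := by
        rintro X Y n h b ⟨j, hj, hi, k, hk, hb⟩
        refine ⟨j, ?_, fun i hij => ?_, k, hk, hb⟩
        · change 0 ∈ (Y j : Set ℕ)
          rw [← h j (by omega)]
          exact hj
        · change ¬ 0 ∈ (Y i : Set ℕ)
          rw [← h i (by omega)]
          exact hi i hij
      intro X Y n h
      ext a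
      exact ⟨fun ⟨b, e, hb⟩ => ⟨b, e, key X Y n h b hb⟩,
        fun ⟨b, e, hb⟩ => ⟨b, e, key Y X n (fun k hk => (h k hk).symm) b hb⟩⟩)
  refine ⟨f, fun w hw => ?_⟩
  funext n b
  have h₁ := congrArg (fun s : Set ℕ => symNum b ∈ s) (hf w hw n)
  have h₂ : ∀ k, (0 ∈ (inputPart inputSet (w k) : Set ℕ)) = (0 ∈ w k) := fun k => by
    simp [inputPart]
  simp only [h₂, Set.mem_inter_iff, Set.mem_ofPred_eq, symNum_mem, and_true, eq_iff_iff] at h₁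
  refine propext (Iff.trans h₁ ⟨?_, fun h => ⟨b, rfl, h⟩⟩)
  rintro ⟨b', e, hb⟩
  rwa [symNum_injective e]

/-- If the traces start with the initial configuration and each trace has a successor trace, then
the machine does not halt. -/
theorem not_dom_of_successors {M : TM0.Machine Γ Q} {l : List Γ}
    {f : Strategy inputSet (outputSet Q Γ)}
    (h₀ : ∀ w ∈ f.traces, 0 ∈ w 0 → Contains (track w) 1 (TM0.init l : TM0.Cfg Γ Q))
    (h : ∀ w ∈ f.traces, ∃ w' ∈ f.traces, ∃ u : Track Q Γ,
      (∀ n b, track w n b → u n b) ∧ StepRel M u (track w')) :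
    ¬ (eval (TM0.step M) (TM0.init l)).Dom := by
  intro hd
  obtain ⟨d, hd'⟩ := Part.dom_iff_mem.1 hd
  obtain ⟨hr, hn⟩ := mem_eval.1 hd'
  -- Containment is monotone, so it passes from the trace to `u`. In the `∀π ∃π'` case `u` is the
  -- track itself, in the other case the quantified copy.
  have step : ∀ w ∈ f.traces, ∀ t c, Contains (track w) t c →
      ∃ c', TM0.step M c = some c' ∧ ∃ w' ∈ f.traces, Contains (track w') (t + 1) c' := by
    intro w hw t c hc
    obtain ⟨w', hw', u, hu, hs⟩ := h w hw
    obtain ⟨c', h₁, h₂⟩ := hs.contains (t := t) (c := c) fun k b hb => hu _ _ (hc k b hb)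
    exact ⟨c', h₁, w', hw', h₂⟩
  -- Induction along the finite run to the halting configuration `d`; by determinism the successor
  -- trace contains the next configuration of this run.
  have reach : ∃ w ∈ f.traces, ∃ t, Contains (track w) t d := by
    clear hd' hn
    induction hr with
    | refl =>
      obtain ⟨w, hw, hx⟩ := exists_mem_traces_of_input f fun _ => True
      exact ⟨w, hw, 1, h₀ w hw ((hx 0).2 trivial)⟩
    | tail _ h₂ ih =>
      obtain ⟨w, hw, t, hc⟩ := ih
      obtain ⟨c', e, w', hw', hc'⟩ := step w hw t _ hc
      obtain rfl := Option.some_injective _ (e.symm.trans h₂)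
      exact ⟨w', hw', t + 1, hc'⟩
  obtain ⟨w, hw, t, hc⟩ := reach
  obtain ⟨c', e, -⟩ := step w hw t d hc
  simp [hn] at e

/-! ### The `∀π ∃π'` formula -/

/-- The symbols on the trace bound to `π`. -/
noncomputable def traceSym (π : ℕ) (b : Sym Q Γ) : Body := .atom (symNum b) π

/-- If the input holds initially, then the initial configuration follows. -/
noncomputable def initialBody (π : ℕ) (l : List Γ) : Body :=
  .imp (.atom 0 π) (.next (startBody (traceSym (Q := Q) π) l))

theorem sat_traceSym {T : Set Trace} {G : Assignment} {π : ℕ} {w : Trace} (h : G π = some w)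
    (t : ℕ) (b : Sym Q Γ) : Body.Sat T G t (traceSym π b) ↔ track w t b := by
  simp [traceSym, Body.Sat, h, track]

theorem sat_initialBody {T : Set Trace} {G : Assignment} {π : ℕ} {w : Trace} (h : G π = some w)
    (l : List Γ) : Body.Sat T G 0 (initialBody (Q := Q) π l) ↔
      (0 ∈ w 0 → Contains (track w) 1 (TM0.init l : TM0.Cfg Γ Q)) := by
  rw [initialBody, Body.sat_imp, Body.sat_next, sat_startBody (sat_traceSym h)]
  simp [Body.Sat, h]

/-- A formula with prefix `∀π ∃π'` which is realizable if and only if `M` does not halt. -/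
noncomputable def allExFormula (M : TM0.Machine Γ Q) (l : List Γ) : Formula :=
  .allTrace 0 (.exTrace 1 (.body (.and (initialBody (Q := Q) 0 l)
    (stepBody M (.atom 0 1) (traceSym 0) (traceSym 1)))))

theorem models_allExFormula {T : Set Trace} {M : TM0.Machine Γ Q} {l : List Γ} :
    Models T (allExFormula M l) ↔ ∀ w ∈ T, ∃ w' ∈ T,
      (0 ∈ w 0 → Contains (track w) 1 (TM0.init l : TM0.Cfg Γ Q)) ∧
      StepRel M (track w) (track w') := by
  simp only [Models, allExFormula, Formula.Sat, Body.sat_and]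
  refine forall₂_congr fun w hw => exists_congr fun w' => and_congr_right fun hw' => ?_
  rw [sat_initialBody (w := w) (by simp), sat_stepBody (sat_traceSym (w := w) (by simp))
    (sat_traceSym (w := w') (by simp))]

theorem realizable_allExFormula (M : TM0.Machine Γ Q) (l : List Γ) :
    Realizable inputSet (outputSet Q Γ) (allExFormula M l) ↔
      ¬ (eval (TM0.step M) (TM0.init l)).Dom := by
  constructor
  · rintro ⟨f, hf⟩
    rw [models_allExFormula] at hf
    refine not_dom_of_successors (f := f) (fun w hw => ?_) fun w hw => ?_
    · obtain ⟨w', -, h, -⟩ := hf w hw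
      exact h
    · obtain ⟨w', hw', -, h⟩ := hf w hw
      exact ⟨w', hw', _, fun _ _ h => h, h⟩
  · intro hd
    obtain ⟨c, hc₀, hc⟩ := exists_run_of_not_dom hd
    obtain ⟨f, hf⟩ := exists_strategy_written c
    refine ⟨f, models_allExFormula.2 fun w hw => ?_⟩
    -- The successor is the trace whose input is that of `w` delayed by one.
    obtain ⟨w', hw', hx⟩ := exists_mem_traces_of_input f
      fun n => n.casesOn False fun n => 0 ∈ w n
    refine ⟨w', hw', fun h => ?_, ?_⟩
    · rw [hf w hw, written_eq_shifted (x := fun n => 0 ∈ w n) h (by simp), hc₀]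
      exact fun k b hb => (shifted_add _ _ _ _).2 hb
    · rw [hf w hw, hf w' hw']
      exact stepRel_written hc (by simp [hx]) fun n => (hx (n + 1)).symm

theorem wellScoped_initialBody {π : ℕ} {V P : Set ℕ} (hπ : π ∈ V) (l : List Γ) :
    (initialBody (Q := Q) π l).WellScoped (inputSet ∪ outputSet Q Γ) V P := by
  have h : ∀ b : Sym Q Γ, (traceSym π b).WellScoped (inputSet ∪ outputSet Q Γ) V P :=
    fun b => ⟨Or.inr (symNum_mem b), hπ⟩
  exact ⟨⟨Or.inl (by simp), hπ⟩, wellScoped_startBody h l⟩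

theorem wellScoped_allExFormula (M : TM0.Machine Γ Q) (l : List Γ) :
    (allExFormula M l).WellScoped inputSet (outputSet Q Γ) ∅ ∅ := by
  have h : ∀ π ∈ (insert 1 (insert 0 ∅) : Set ℕ), ∀ b : Sym Q Γ, (traceSym π b).WellScoped
      (inputSet ∪ outputSet Q Γ) (insert 1 (insert 0 ∅)) ∅ :=
    fun π hπ b => ⟨Or.inr (symNum_mem b), hπ⟩
  have h₀ : (Body.atom 0 1).WellScoped (inputSet ∪ outputSet Q Γ) (insert 1 (insert 0 ∅)) ∅ :=
    ⟨Or.inl (by simp), by simp⟩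
  exact ⟨by simp, by simp, wellScoped_initialBody (by simp) l,
    wellScoped_stepBody h₀ (h 0 (by simp)) (h 1 (by simp)) M⟩

/-! ### The `∀q ∃q* ∀π` formula -/

/-- Existential quantification over a list of propositions. -/
def exProps (l : List ℕ) (φ : Formula) : Formula := l.foldr Formula.exProp φ

/-- The sequences of the propositions in `l` are replaced by `P`. -/
def overrideAll (T : Set Trace) (l : List ℕ) (P : ℕ → ℕ → Prop) : Set Trace :=
  {t' | ∃ t ∈ T, t' = fun i => {a | (a ∈ l ∧ P a i) ∨ (a ∉ l ∧ a ∈ t i)}}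

/-- A replacement by `l` overwrites an earlier one at `p` if `p ∈ l`, so `tp` matters only for `p ∉
l`. -/
theorem overrideAll_replaceAll (T : Set Trace) (p : ℕ) (l : List ℕ) (tp : ℕ → Prop)
    (P P' : ℕ → ℕ → Prop) (h : ∀ a ∈ l, P' a = P a) (hp : p ∉ l → P' p = tp) :
    overrideAll (replaceAll T p tp) l P = overrideAll T (p :: l) P' := by
  have key : ∀ t : Trace, (fun i => {a | (a ∈ l ∧ P a i) ∨ (a ∉ l ∧ a ∈ t.replace p tp i)}) =
      fun i => {a | (a ∈ p :: l ∧ P' a i) ∨ (a ∉ p :: l ∧ a ∈ t i)} := by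
    intro t
    funext i
    ext a
    by_cases ha : a ∈ l
    · simp [ha, h a ha]
    · by_cases hap : a = p
      · subst hap
        simp [ha, hp ha, Trace.replace]
      · simp [ha, hap, Trace.replace]
  ext t'
  constructor
  · rintro ⟨_, ⟨t, ht, rfl⟩, rfl⟩
    exact ⟨t, ht, key t⟩
  · rintro ⟨t, ht, rfl⟩
    exact ⟨_, ⟨t, ht, rfl⟩, (key t).symm⟩

/-- Turns a block of existential propositions into a single choice of all their sequences. -/
theorem sat_exProps {T : Set Trace} {G : Assignment} {i : ℕ} {l : List ℕ} {φ : Formula} :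
    Formula.Sat T G i (exProps l φ) ↔ ∃ P, Formula.Sat (overrideAll T l P) G i φ := by
  classical
  induction l generalizing T with
  | nil =>
    have : ∀ P, overrideAll T [] P = T := fun P => by
      ext t
      simp [overrideAll]
    simp [this, exProps]
  | cons p l ih =>
    rw [exProps, List.foldr_cons, ← exProps, Formula.Sat]
    simp only [ih]
    constructor
    · rintro ⟨tp, P, h⟩
      refine ⟨fun a => if a ∈ l then P a else tp, ?_⟩
      rwa [← overrideAll_replaceAll T p l tp P _ (fun a ha => if_pos ha) (fun hp => if_neg hp)]
    · rintro ⟨P, h⟩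
      refine ⟨P p, P, ?_⟩
      rwa [overrideAll_replaceAll T p l (P p) P P (fun _ _ => rfl) fun _ => rfl]

/-- The quantified copy of a symbol. -/
noncomputable def propSym (b : Sym Q Γ) : Body := .prop (copyNum b)

variable (Q Γ) in
/-- The propositions for the quantified copies of the symbols. -/
noncomputable def copyList : List ℕ := (Finset.univ : Finset (Sym Q Γ)).toList.map copyNum

theorem mem_copyList {a : ℕ} : a ∈ copyList Q Γ ↔ ∃ b : Sym Q Γ, copyNum b = a := by
  simp only [copyList, List.mem_map, Finset.mem_toList, Finset.mem_univ, true_and]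

/-- The body of `allPropFormula`. -/
noncomputable def allPropBody (M : TM0.Machine Γ Q) (l : List Γ) : Body :=
  .and (initialBody (Q := Q) 1 l) (.and
    (.imp (.glob (.iff (.atom 0 1) (.prop 1)))
      (.conj (.atom 0 1) fun b : Sym Q Γ => .glob (.imp (traceSym 1 b) (propSym b))))
    (.imp (.and (.neg (.atom 0 1)) (.glob (.iff (.prop 1) (.next (.atom 0 1)))))
      (stepBody M (.atom 0 1) propSym (traceSym 1))))

/-- A formula with prefix `∀q ∃q* ∀π` which is realizable if and only if `M` does not halt. -/
noncomputable def allPropFormula (M : TM0.Machine Γ Q) (l : List Γ) : Formula :=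
  .allProp 1 (exProps (copyList Q Γ) (.allTrace 1 (.body (allPropBody M l))))

/-- Here `w` is a trace of the strategy and `w'` the same trace after the propositional
replacements. These do not touch the input and the `symNum` outputs, so the conditions can be stated
for `w`. -/
theorem sat_allPropBody {T : Set Trace} {w w' : Trace} {q : ℕ → Prop} {u : Track Q Γ}
    (h₀ : ∀ n, 0 ∈ w' n ↔ 0 ∈ w n) (hs : ∀ n (b : Sym Q Γ), symNum b ∈ w' n ↔ symNum b ∈ w n)
    (hq : ∀ n, (∀ t ∈ T, 1 ∈ t n) ↔ q n) (hu : ∀ n b, (∀ t ∈ T, copyNum b ∈ t n) ↔ u n b)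
    {G : Assignment} (hG : G 1 = some w') {M : TM0.Machine Γ Q} {l : List Γ} :
    Body.Sat T G 0 (allPropBody M l) ↔
      (0 ∈ w 0 → Contains (track w) 1 (TM0.init l : TM0.Cfg Γ Q)) ∧
      ((∀ n, 0 ∈ w n ↔ q n) → ∀ n b, track w n b → u n b) ∧
      (0 ∉ w 0 ∧ (∀ n, q n ↔ 0 ∈ w (n + 1)) → StepRel M u (track w)) := by
  have hA : ∀ n, Body.Sat T G n (.atom 0 1) ↔ 0 ∈ w n := fun n => by
    simp [Body.Sat, hG, h₀]
  have ht : track w' = (track w : Track Q Γ) := by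
    funext n b
    exact propext (hs n b)
  have hS : ∀ n b, Body.Sat T G n (traceSym 1 b) ↔ (track w : Track Q Γ) n b := fun n b => by
    rw [sat_traceSym hG, ht]
  have hP : ∀ n b, Body.Sat T G n (propSym b) ↔ u n b := fun n b => by
    rw [propSym, Body.sat_prop, hu]
  rw [allPropBody, Body.sat_and, Body.sat_and, Body.sat_imp, Body.sat_imp, Body.sat_and,
    Body.sat_neg, sat_initialBody hG, sat_stepBody hP hS, ht, h₀]
  simp only [Body.sat_glob, Body.sat_iff, Body.sat_conj, Body.sat_imp, Body.sat_next, hA, hS, hP,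
    Body.sat_prop, hq, zero_add]
  rw [forall_comm (α := Sym Q Γ)]

/-- Nonemptiness is needed because a quantified proposition is evaluated on all traces of `T`: on an
empty set it would hold vacuously, whatever sequence was chosen. -/
theorem models_allPropFormula {T : Set Trace} (hT : T.Nonempty) {M : TM0.Machine Γ Q}
    {l : List Γ} : Models T (allPropFormula M l) ↔ ∀ q : ℕ → Prop, ∃ u : Track Q Γ, ∀ w ∈ T,
      (0 ∈ w 0 → Contains (track w) 1 (TM0.init l : TM0.Cfg Γ Q)) ∧
      ((∀ n, 0 ∈ w n ↔ q n) → ∀ n b, track w n b → u n b) ∧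
      (0 ∉ w 0 ∧ (∀ n, q n ↔ 0 ∈ w (n + 1)) → StepRel M u (track w)) := by
  obtain ⟨w₀, hw₀⟩ := hT
  have h1 : 1 ∉ copyList Q Γ := by
    rw [mem_copyList]
    rintro ⟨b, hb⟩
    unfold copyNum at hb
    omega
  have h0 : 0 ∉ copyList Q Γ := by
    rw [mem_copyList]
    rintro ⟨b, hb⟩
    unfold copyNum at hb
    omega
  have hb' : ∀ b : Sym Q Γ, symNum b ∉ copyList Q Γ := by
    intro b
    rw [mem_copyList]
    rintro ⟨c, hc⟩
    exact symNum_ne_copyNum b c hc.symm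
  have hs1 : ∀ b : Sym Q Γ, symNum b ≠ 1 := by
    intro b
    unfold symNum
    omega
  simp only [Models, allPropFormula, Formula.Sat, sat_exProps]
  refine forall_congr' fun q => ?_
  have key : ∀ P : ℕ → ℕ → Prop,
      (∀ t ∈ overrideAll (replaceAll T 1 q) (copyList Q Γ) P,
        Body.Sat (overrideAll (replaceAll T 1 q) (copyList Q Γ) P)
          (Function.update (fun _ => none) 1 (some t)) 0 (allPropBody M l)) ↔
      ∀ w ∈ T, (0 ∈ w 0 → Contains (track w) 1 (TM0.init l : TM0.Cfg Γ Q)) ∧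
        ((∀ n, 0 ∈ w n ↔ q n) → ∀ n b, track w n b → P (copyNum (b : Sym Q Γ)) n) ∧
        (0 ∉ w 0 ∧ (∀ n, q n ↔ 0 ∈ w (n + 1)) →
          StepRel M (fun n b => P (copyNum b) n) (track w)) := by
    intro P
    have hq : ∀ n, (∀ t ∈ overrideAll (replaceAll T 1 q) (copyList Q Γ) P, 1 ∈ t n) ↔ q n := by
      intro n
      constructor
      · intro h
        simpa [h1, Trace.replace] using h _ ⟨_, ⟨w₀, hw₀, rfl⟩, rfl⟩
      · rintro h _ ⟨_, ⟨w, hw, rfl⟩, rfl⟩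
        simpa [h1, Trace.replace] using h
    have hu : ∀ n (b : Sym Q Γ), (∀ t ∈ overrideAll (replaceAll T 1 q) (copyList Q Γ) P,
        copyNum b ∈ t n) ↔ P (copyNum b) n := by
      intro n b
      have hb : copyNum b ∈ copyList Q Γ := mem_copyList.2 ⟨b, rfl⟩
      constructor
      · intro h
        simpa [hb] using h _ ⟨_, ⟨w₀, hw₀, rfl⟩, rfl⟩
      · rintro h _ ⟨_, ⟨w, hw, rfl⟩, rfl⟩
        simpa [hb] using h
    constructor
    · intro h w hw
      exact (sat_allPropBody (by simp [h0, Trace.replace])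
        (by simp [hb', hs1, Trace.replace]) hq hu (Function.update_self ..)).1
          (h _ ⟨_, ⟨w, hw, rfl⟩, rfl⟩)
    · rintro h _ ⟨_, ⟨w, hw, rfl⟩, rfl⟩
      exact (sat_allPropBody (by simp [h0, Trace.replace])
        (by simp [hb', hs1, Trace.replace]) hq hu (Function.update_self ..)).2 (h w hw)
  simp only [key]
  constructor
  · rintro ⟨P, h⟩
    exact ⟨_, h⟩
  · rintro ⟨u, h⟩
    -- Transports `u` to propositions along the injection `copyNum`.
    refine ⟨fun a n => ∃ b, copyNum b = a ∧ u n b, ?_⟩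
    have : ∀ n b, (∃ b', copyNum b' = copyNum b ∧ u n b') ↔ u n b := fun n b =>
      ⟨fun ⟨b', e, h⟩ => copyNum_injective e ▸ h, fun h => ⟨b, rfl, h⟩⟩
    simpa only [this] using h

/-- For a trace `w`, let `q` be its input. The `u` chosen for this `q` contains the track of `w`,
and the same `u` is related by `StepRel` to the trace with delayed input, because `u` is chosen
before `π`. -/
theorem realizable_allPropFormula (M : TM0.Machine Γ Q) (l : List Γ) :
    Realizable inputSet (outputSet Q Γ) (allPropFormula M l) ↔
      ¬ (eval (TM0.step M) (TM0.init l)).Dom := by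
  have ne : ∀ f : Strategy inputSet (outputSet Q Γ), f.traces.Nonempty := fun f =>
    let ⟨w, hw, _⟩ := exists_mem_traces_of_input f fun _ => True
    ⟨w, hw⟩
  constructor
  · rintro ⟨f, hf⟩
    rw [models_allPropFormula (ne f)] at hf
    refine not_dom_of_successors (f := f) (fun w hw => ?_) fun w hw => ?_
    -- The initial condition does not involve `q`, so any choice serves.
    · obtain ⟨u, hu⟩ := hf fun _ => True
      exact (hu w hw).1
    · obtain ⟨u, hu⟩ := hf fun n => 0 ∈ w n
      obtain ⟨w', hw', hx⟩ := exists_mem_traces_of_input f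
        fun n => n.casesOn False fun n => 0 ∈ w n
      exact ⟨w', hw', u, (hu w hw).2.1 fun _ => Iff.rfl,
        (hu w' hw').2.2 ⟨by simp [hx], fun n => (hx (n + 1)).symm⟩⟩
  · intro hd
    obtain ⟨c, hc₀, hc⟩ := exists_run_of_not_dom hd
    obtain ⟨f, hf⟩ := exists_strategy_written c
    -- On the intended strategy the track is a function of the input, so `u` can be computed from
    -- `q` alone.
    refine ⟨f, (models_allPropFormula (ne f)).2 fun q => ⟨written c q, fun w hw => ?_⟩⟩
    rw [hf w hw]
    refine ⟨fun h => ?_, fun h n b hb => ?_, fun h => stepRel_written hc h.1 h.2⟩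
    · rw [written_eq_shifted (x := fun n => 0 ∈ w n) h (by simp), hc₀]
      exact fun k b hb => (shifted_add _ _ _ _).2 hb
    · simpa only [h] using hb

theorem wellScoped_exProps {I O V P : Set ℕ} {l : List ℕ} {φ : Formula} (hl : l.Nodup)
    (hO : ∀ a ∈ l, a ∈ O) (hP : ∀ a ∈ l, a ∉ P)
    (hφ : φ.WellScoped I O V (P ∪ {a | a ∈ l})) : (exProps l φ).WellScoped I O V P := by
  induction l generalizing P with
  | nil => simpa [exProps] using hφ
  | cons p l ih =>
    rw [List.nodup_cons] at hl
    refine ⟨hO p (by simp), hP p (by simp),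
      ih hl.2 (fun a ha => hO a (by simp [ha])) (fun a ha => ?_) ?_⟩
    · rintro (rfl | h)
      · exact hl.1 ha
      · exact hP a (by simp [ha]) h
    · convert hφ using 1
      ext a
      simp only [Set.mem_union, Set.mem_insert_iff, Set.mem_ofPred_eq, List.mem_cons]
      tauto

theorem wellScoped_allPropFormula (M : TM0.Machine Γ Q) (l : List Γ) :
    (allPropFormula M l).WellScoped inputSet (outputSet Q Γ) ∅ ∅ := by
  refine ⟨by simp [mem_outputList], by simp, wellScoped_exProps ?_ ?_ ?_ ⟨by simp, ?_⟩⟩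
  · exact (Finset.nodup_toList _).map copyNum_injective
  · intro a ha
    obtain ⟨b, rfl⟩ := mem_copyList.1 ha
    exact copyNum_mem b
  · intro a ha
    obtain ⟨b, rfl⟩ := mem_copyList.1 ha
    simp [copyNum]
  · let R : Set ℕ := insert 1 ∅ ∪ {a | a ∈ copyList Q Γ}
    have h₀ : (Body.atom 0 1).WellScoped (inputSet ∪ outputSet Q Γ) (insert 1 ∅) R :=
      ⟨Or.inl (by simp), by simp⟩
    have h₁ : (Body.prop 1).WellScoped (inputSet ∪ outputSet Q Γ) (insert 1 ∅) R :=
      Or.inl (by simp)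
    have hs : ∀ b : Sym Q Γ,
        (traceSym 1 b).WellScoped (inputSet ∪ outputSet Q Γ) (insert 1 ∅) R :=
      fun b => ⟨Or.inr (symNum_mem b), by simp⟩
    have hp : ∀ b : Sym Q Γ,
        (propSym b).WellScoped (inputSet ∪ outputSet Q Γ) (insert 1 ∅) R :=
      fun b => Or.inr (mem_copyList.2 ⟨b, rfl⟩)
    exact ⟨wellScoped_initialBody (by simp) l,
      ⟨Body.wellScoped_glob.2 (Body.wellScoped_iff.2 ⟨h₀, h₁⟩),
        Body.wellScoped_conj h₀ fun b => ⟨hs b, hp b⟩⟩,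
      ⟨h₀, Body.wellScoped_glob.2 (Body.wellScoped_iff.2 ⟨h₁, h₀⟩)⟩,
      wellScoped_stepBody h₀ hp hs M⟩

end Reduction

/-! ### Computability of the reduction -/

section Primrec

open Primrec

theorem primrec_body_of_code {α : Type*} [Primcodable α] {f : α → Body}
    (h : Primrec fun a => (f a).code) : Primrec f :=
  Primrec.encode_iff.1 (h.of_eq fun a => (Body.encode_eq (f a)).symm)

theorem primrec_formula_of_code {α : Type*} [Primcodable α] {f : α → Formula}
    (h : Primrec fun a => (f a).code) : Primrec f :=
  Primrec.encode_iff.1 (h.of_eq fun a => (Formula.encode_eq (f a)).symm)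

theorem primrec_body_code : Primrec Body.code :=
  Primrec.encode.of_eq Body.encode_eq

theorem primrec_formula_code : Primrec Formula.code :=
  Primrec.encode.of_eq Formula.encode_eq

variable {α : Type*} [Primcodable α] {f g : α → Body} {φ : α → Formula}

theorem primrec_neg (hf : Primrec f) : Primrec fun a => Body.neg (f a) :=
  primrec_body_of_code <| nat_add.comp
    (nat_mul.comp (const 6) (primrec_body_code.comp hf)) (const 2)

theorem primrec_or (hf : Primrec f) (hg : Primrec g) : Primrec fun a => Body.or (f a) (g a) :=
  primrec_body_of_code <| nat_add.comp (nat_mul.comp (const 6)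
    (Primrec₂.natPair.comp (primrec_body_code.comp hf) (primrec_body_code.comp hg))) (const 3)

theorem primrec_next (hf : Primrec f) : Primrec fun a => Body.next (f a) :=
  primrec_body_of_code <| nat_add.comp
    (nat_mul.comp (const 6) (primrec_body_code.comp hf)) (const 4)

theorem primrec_and (hf : Primrec f) (hg : Primrec g) : Primrec fun a => Body.and (f a) (g a) :=
  primrec_neg (primrec_or (primrec_neg hf) (primrec_neg hg))

theorem primrec_imp (hf : Primrec f) (hg : Primrec g) : Primrec fun a => Body.imp (f a) (g a) :=
  primrec_or (primrec_neg hf) hg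

theorem primrec_formula_body (hf : Primrec f) : Primrec fun a => Formula.body (f a) :=
  primrec_formula_of_code <| nat_mul.comp (const 5) (primrec_body_code.comp hf)

theorem primrec_allTrace (π : ℕ) (h : Primrec φ) : Primrec fun a => Formula.allTrace π (φ a) :=
  primrec_formula_of_code <| nat_add.comp (nat_mul.comp (const 5)
    (Primrec₂.natPair.comp (const π) (primrec_formula_code.comp h))) (const 1)

theorem primrec_exTrace (π : ℕ) (h : Primrec φ) : Primrec fun a => Formula.exTrace π (φ a) :=
  primrec_formula_of_code <| nat_add.comp (nat_mul.comp (const 5)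
    (Primrec₂.natPair.comp (const π) (primrec_formula_code.comp h))) (const 2)

theorem primrec_allProp (q : ℕ) (h : Primrec φ) : Primrec fun a => Formula.allProp q (φ a) :=
  primrec_formula_of_code <| nat_add.comp (nat_mul.comp (const 5)
    (Primrec₂.natPair.comp (const q) (primrec_formula_code.comp h))) (const 3)

theorem primrec_exProp (q : ℕ) (h : Primrec φ) : Primrec fun a => Formula.exProp q (φ a) :=
  primrec_formula_of_code <| nat_add.comp (nat_mul.comp (const 5)
    (Primrec₂.natPair.comp (const q) (primrec_formula_code.comp h))) (const 4)

theorem primrec_exProps (l : List ℕ) (h : Primrec φ) : Primrec fun a => exProps l (φ a) := by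
  induction l with
  | nil => exact h
  | cons p l ih => exact primrec_exProp p ih

/-- The binary digits of a number, computed by iteration. -/
theorem iterate_div_two_append_bits (k n : ℕ) (h : n ≤ k) (s : List Bool) :
    ((fun p : ℕ × List Bool => if p.1 = 0 then p else (p.1.div2, p.1.bodd :: p.2))^[k]
      (n, s)).2 = n.bits.reverse ++ s := by
  induction k generalizing n s with
  | zero =>
    obtain rfl : n = 0 := by omega
    simp
  | succ k ih =>
    rw [Function.iterate_succ_apply]
    by_cases hn : n = 0
    · subst hn
      simpa using ih 0 (Nat.zero_le k) s
    · have hlt : n.div2 < n := by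
        rw [Nat.div2_val]
        omega
      have hb : n.bits = n.bodd :: n.div2.bits := by
        conv_lhs => rw [← Nat.bit_bodd_div2 n]
        refine Nat.bits_append_bit _ _ fun h0 => ?_
        by_contra hf
        apply hn
        rw [← Nat.bit_bodd_div2 n, h0]
        simpa using hf
      simp only [hn, if_false]
      rw [ih _ (by omega), hb]
      simp

theorem primrec_bits_reverse : Primrec fun n : ℕ => n.bits.reverse := by
  have h : Primrec fun p : ℕ × List Bool =>
      if p.1 = 0 then p else (p.1.div2, p.1.bodd :: p.2) :=
    Primrec.ite (Primrec.eq.comp fst (const 0)) Primrec.id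
      ((nat_div2.comp fst).pair (list_cons.comp (nat_bodd.comp fst) snd))
  -- Halving `n` for `n` rounds certainly reaches 0, and further rounds change nothing.
  exact (snd.comp (nat_iterate Primrec.id (Primrec.id.pair (const [])) (h.comp snd).to₂)).of_eq
    fun n => by simpa using iterate_div_two_append_bits n n le_rfl []

end Primrec

/-! ### Computable families of formulas and the undecidable fragments -/

section Main

set_option linter.unusedSectionVars false

variable {Q Γ : Type} [Fintype Q] [Fintype Γ] [Inhabited Q] [Inhabited Γ]

/-- This is the only part of the formulas that varies with `n`: a fold over the reversed binary
digits. -/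
theorem primrec_tapeBody (A : Sym Q Γ → Body) (a : Γ) (b : Bool → Γ) :
    Primrec fun n : ℕ => tapeBody A (a :: (n.bits.map b).reverse) := by
  have h : Primrec fun n : ℕ => n.bits.reverse.foldr
      (fun x φ => Body.and (A (Sym.right (b x))) (.next φ)) (.glob (A (Sym.right default))) :=
    Primrec.list_foldr primrec_bits_reverse (Primrec.const _)
      (primrec_and ((Primrec.dom_finite fun x : Bool => A (Sym.right (b x))).comp
        (Primrec.fst.comp Primrec.snd)) (primrec_next (Primrec.snd.comp Primrec.snd))).to₂
  refine (primrec_and (Primrec.const (A (Sym.right a))) (primrec_next h)).of_eq fun n => ?_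
  rw [tapeBody, ← List.map_reverse, List.foldr_cons, List.foldr_map]

theorem primrec_initialBody (π : ℕ) (a : Γ) (b : Bool → Γ) :
    Primrec fun n : ℕ => initialBody (Q := Q) π (a :: (n.bits.map b).reverse) :=
  primrec_imp (Primrec.const _) <| primrec_next <| primrec_and (Primrec.const _) <|
    primrec_and (Primrec.const _) (primrec_tapeBody _ a b)

theorem primrec_allExFormula (M : TM0.Machine Γ Q) (a : Γ) (b : Bool → Γ) :
    Primrec fun n : ℕ => allExFormula M (a :: (n.bits.map b).reverse) :=
  primrec_allTrace 0 <| primrec_exTrace 1 <| primrec_formula_body <|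
    primrec_and (primrec_initialBody 0 a b) (Primrec.const _)

theorem primrec_allPropFormula (M : TM0.Machine Γ Q) (a : Γ) (b : Bool → Γ) :
    Primrec fun n : ℕ => allPropFormula M (a :: (n.bits.map b).reverse) :=
  primrec_allProp 1 <| primrec_exProps _ <| primrec_allTrace 1 <| primrec_formula_body <|
    primrec_and (primrec_initialBody 1 a b) (Primrec.const _)

/-- Realizability is undecidable on every fragment that contains a computable family of formulas
whose realizability expresses that a machine does not halt. -/
theorem not_decidableOn_of_family {C : Language Quantifier} {p : ℕ → Prop}
    (hp : ¬ ComputablePred p) (φ : ℕ → Formula) (hφ : Primrec φ)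
    (hw : ∀ n, (φ n).WellScoped inputSet (outputSet Q Γ) ∅ ∅) (hC : ∀ n, (φ n).quantifiers ∈ C)
    (h : ∀ n, Realizable inputSet (outputSet Q Γ) (φ n) ↔ ¬ p n) :
    ¬ RealizabilityDecidableOn C := by
  rintro ⟨P, hP, hPC⟩
  let x : ℕ → Instance := fun n => (([0], outputList Q Γ), φ n)
  have hx : Computable x := ((Primrec.const _).pair hφ).to_comp
  have hn : ComputablePred fun n => ¬ p n := by
    refine (ComputablePred.computable_of_manyOneReducible ⟨x, hx, fun n => Iff.rfl⟩ hP).of_eq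
      fun n => ?_
    exact (hPC (x n) ⟨disjoint_inputSet_outputSet, hw n⟩ (hC n)).trans (h n)
  exact hp (hn.not.of_eq fun n => not_not)

end Main

theorem RealizabilityDecidableOn.mono {C D : Language Quantifier} (h : C ≤ D)
    (hD : RealizabilityDecidableOn D) : RealizabilityDecidableOn C :=
  let ⟨P, hP, hPD⟩ := hD
  ⟨P, hP, fun x hx hC => hPD x hx (h hC)⟩

theorem quantifiers_exProps (l : List ℕ) (φ : Formula) :
    (exProps l φ).quantifiers = List.replicate l.length Quantifier.exProp ++ φ.quantifiers := by
  induction l with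
  | nil => rfl
  | cons p l ih =>
    rw [exProps, List.foldr_cons, ← exProps, Formula.quantifiers, ih]
    rfl

/-- In the tight fragment no trace quantifier follows the `∀π`. If nothing precedes the `∀π`, the
final `∃π'` would have to be propositional; otherwise the word would contain a second `∀π`. -/
theorem allPi_mul_exPi_le : allPi * exPi ≤ outsideTightFragment := by
  rintro _ ⟨_, rfl, _, rfl, rfl⟩
  refine ⟨rfl, ?_⟩
  rintro ⟨_, ⟨_, ⟨u, hu, v, hv, rfl⟩, _, rfl, rfl⟩, w, hw, e⟩
  have hw' : Quantifier.exTrace ∉ w := by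
    obtain ⟨L, rfl, hL⟩ := Language.mem_kstar.1 hw
    rw [List.mem_flatten]
    rintro ⟨y, hy, hy'⟩
    rcases hL y hy with rfl | rfl <;> simp at hy'
  change (u ++ v) ++ [Quantifier.allTrace] ++ w = [Quantifier.allTrace, Quantifier.exTrace] at e
  rcases h : u ++ v with _ | ⟨c, s⟩
  · rw [h] at e
    simp only [List.nil_append, List.singleton_append, List.cons.injEq, true_and] at e
    exact hw' (by simp [e])
  · rw [h] at e
    have hl := congrArg (List.count Quantifier.allTrace) e
    simp only [List.cons_append, List.cons.injEq] at e
    obtain ⟨rfl, -⟩ := e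
    simp at hl

theorem not_decidableOn_allPi_exPi : ¬ RealizabilityDecidableOn (allPi * exPi) := by
  obtain ⟨Q, Γ, _, _, _, _, M, a, b, h⟩ := exists_undecidable_machine
  exact not_decidableOn_of_family h _ (primrec_allExFormula M a b)
    (fun n => wellScoped_allExFormula M _) (fun n => ⟨_, rfl, _, rfl, rfl⟩)
    fun n => realizable_allExFormula M _

theorem not_decidableOn_allQ_exQ_allPi : ¬ RealizabilityDecidableOn (allQ∗ * exQ∗ * allPi) := by
  obtain ⟨Q, Γ, _, _, _, _, M, a, b, h⟩ := exists_undecidable_machine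
  refine not_decidableOn_of_family h _ (primrec_allPropFormula M a b)
    (fun n => wellScoped_allPropFormula M _) (fun n => ?_)
    fun n => realizable_allPropFormula M _
  rw [allPropFormula, Formula.quantifiers, quantifiers_exProps]
  refine ⟨_, ⟨[.allProp], ?_, _, ?_, rfl⟩, _, rfl, rfl⟩
  · exact Language.mem_kstar.2 ⟨[[.allProp]], rfl, fun y hy => List.mem_singleton.1 hy⟩
  · refine Language.mem_kstar.2 ⟨List.replicate (copyList Q Γ).length [.exProp], by simp, ?_⟩
    intro y hy
    exact (List.mem_replicate.1 hy).2

end HyperQPTL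

theorem mainTheorem2 :
    ¬ HyperQPTL.RealizabilityDecidableOn HyperQPTL.outsideTightFragment ∧
    ¬ HyperQPTL.RealizabilityDecidableOn
        (HyperQPTL.allQ∗ * HyperQPTL.exQ∗ * HyperQPTL.allPi) ∧
    ¬ HyperQPTL.RealizabilityDecidableOn (HyperQPTL.allPi * HyperQPTL.exPi) :=
  ⟨fun h => HyperQPTL.not_decidableOn_allPi_exPi (h.mono HyperQPTL.allPi_mul_exPi_le),
    HyperQPTL.not_decidableOn_allQ_exQ_allPi, HyperQPTL.not_decidableOn_allPi_exPi⟩
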